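/- Let $r\ge 1$, let $\mathcal A_r$ be the Cayley--Dickson algebra over $\mathbb R$ of dimension $2^r$ with standard generators $i_0=1,i_1,\dots,i_{2^r-1}$, Euclidean norm $|\cdot|$ and $e^z=\sum_{m\ge0}z^m/m!$, and let $2^{r-1}\le n\le 2^r-1$. Let $N_j=\varphi(i_j)$, $0\le j\le 2^r-1$, for some $\mathbb R$-algebra automorphism $\varphi$ of $\mathcal A_r$, and write $z=\sum_j z_jN_j$ with $z_j\in\mathbb R$ for $z\in\mathcal A_r$. A function $f:\mathbb R^n\to\mathcal A_r$ is called an original with exponents $(a_1,a_{-1})\in\mathbb R^2$ if: (1) $f$ is continuous at Lebesgue-almost every point; (2) as a function of each single variable $t_j$, the others being fixed, $f$ has on each bounded interval only finitely many points of discontinuity, all of them of the first kind (finite one-sided limits exist); (3) for each $t\in\mathbb R^n$ and $j$ such that $f$ is continuous in the variable $t_j$ at $t$, there are $A>0$, $0<\alpha\le1$, $\delta>0$ with $|f(t+he_j)-f(t)|\le A|h|^{\alpha}$ whenever $|h|<\delta$; (4) for each $v\in\{-1,1\}^n$ there is $C_v>0$ with $|f(t)|<C_v\exp\big(\sum_{j=1}^n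 a_{v_j}t_j\big)$ for all $t\in\mathbb R^n$ with $v_jt_j\ge0$ for all $j$. Put $t_j=0$ for $j>n$ and $s_j=t_j+\dots+t_n$. Consider parameters $p,\zeta\in\mathcal A_r$ with $p_j=\zeta_j=0$ for $j>n$, and let $u(p,t;\zeta)$ be either the Cartesian phase $$u=p_0(t_1+\dots+t_n)+\sum_{j=1}^{2^r-1}p_jt_jN_j+\zeta$$ or the spherical phase $$u=p_0s_1+\zeta_0+\theta_1\big[N_1\cos\theta_2+N_2\sin\theta_2\cos\theta_3+\dots+N_{d-1}\sin\theta_2\cdots\sin\theta_{d-1}\cos\theta_{d}+N_{d}\sin\theta_2\cdots\sin\theta_{d}\big],$$ where $d=2^r-1$ and $\theta_j=p_js_j+\zeta_j$ (for $d=1$ the bracket is $N_1$). The image of $f$ is ${}_NF_u^n(p;\zeta)=\int_{\mathbb R^n}f(t)\,e^{-u(p,t;\zeta)}\,dt$, considered for $a_1<\operatorname{Re}p<a_{-1}$. Theorem 7 (uniqueness). For either choice of $u$, an original $f$ is completely determined by its image ${}_NF_u^n(p;\zeta)$, as a function of $p$ and $\zeta$, up to its values at points of discontinuity. That is: let $f$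 and $g$ be originals with exponents $(a_1,a_{-1})$ and $(b_1,b_{-1})$ such that $\max(a_1,b_1)<\min(a_{-1},b_{-1})$. If the images of $f$ and $g$ coincide for all parameters $p,\zeta$ with $\max(a_1,b_1)<\operatorname{Re}p<\min(a_{-1},b_{-1})$, then $f(t)=g(t)$ at every point $t\in\mathbb R^n$ at which both $f$ and $g$ are continuous. -/

import Mathlib

open Set Filter Topology MeasureTheory


noncomputable section

/-- The underlying space of the Cayley-Dickson algebra of real dimension `2 ^ r`: the Euclidean
space of the coordinates `z_0, …, z_{2 ^ r - 1}` of `z = ∑ z_j i_j`. -/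
def CayleyDickson (r : ℕ) : Type := EuclideanSpace ℝ (Fin (2 ^ r))

namespace CayleyDickson

instance (r : ℕ) : NormedAddCommGroup (CayleyDickson r) :=
  inferInstanceAs (NormedAddCommGroup (EuclideanSpace ℝ (Fin (2 ^ r))))

instance (r : ℕ) : InnerProductSpace ℝ (CayleyDickson r) :=
  inferInstanceAs (InnerProductSpace ℝ (EuclideanSpace ℝ (Fin (2 ^ r))))

instance (r : ℕ) : FiniteDimensional ℝ (CayleyDickson r) :=
  inferInstanceAs (FiniteDimensional ℝ (EuclideanSpace ℝ (Fin (2 ^ r))))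

instance (r : ℕ) : CompleteSpace (CayleyDickson r) :=
  inferInstanceAs (CompleteSpace (EuclideanSpace ℝ (Fin (2 ^ r))))

/-- The element with coordinates `c 0, …, c (2 ^ r - 1)`. -/
def ofCoord (r : ℕ) (c : ℕ → ℝ) : CayleyDickson r :=
  (WithLp.toLp 2 fun j : Fin (2 ^ r) => c j : EuclideanSpace ℝ (Fin (2 ^ r)))

/-- The `j`-th real coordinate `z_j` of `z`, equal to `0` for `j ≥ 2 ^ r`. -/
def coord {r : ℕ} (z : CayleyDickson r) (j : ℕ) : ℝ :=
  if h : j < 2 ^ r then (show EuclideanSpace ℝ (Fin (2 ^ r)) from z) ⟨j, h⟩ else 0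

/-- The standard generators `i_0 = 1, i_1, …, i_{2 ^ r - 1}`. -/
def gen (r : ℕ) (j : ℕ) : CayleyDickson r := ofCoord r fun k => if k = j then 1 else 0

/-- The component `ξ` of `ξ + η l`, where `l = i_{2 ^ r}`. -/
def fstHalf {r : ℕ} (z : CayleyDickson (r + 1)) : CayleyDickson r :=
  ofCoord r fun j => z.coord j

/-- The component `η` of `ξ + η l`, where `l = i_{2 ^ r}` and `i_j l = i_{2 ^ r + j}`. -/
def sndHalf {r : ℕ} (z : CayleyDickson (r + 1)) : CayleyDickson r :=
  ofCoord r fun j => z.coord (2 ^ r + j)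

/-- The element `ξ + η l` of the doubled algebra. -/
def double {r : ℕ} (ξ η : CayleyDickson r) : CayleyDickson (r + 1) :=
  ofCoord (r + 1) fun j => if j < 2 ^ r then ξ.coord j else η.coord (j - 2 ^ r)

/-- Conjugation: trivial on the reals, and `(ξ + η l)^* = ξ^* - η l`. -/
def conj : (r : ℕ) → CayleyDickson r → CayleyDickson r
  | 0, z => z
  | r + 1, z => double (conj r (fstHalf z)) (-sndHalf z)

/-- Multiplication: that of `ℝ` for `r = 0`, and
`(ξ + η l)(γ + δ l) = (ξ γ - δ^* η) + (δ ξ + η γ^*) l` in the doubled algebra. -/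
def mul : (r : ℕ) → CayleyDickson r → CayleyDickson r → CayleyDickson r
  | 0, x, y => ofCoord 0 fun j => x.coord j * y.coord j
  | r + 1, x, y =>
      double (mul r (fstHalf x) (fstHalf y) - mul r (conj r (sndHalf y)) (sndHalf x))
        (mul r (sndHalf y) (fstHalf x) + mul r (sndHalf x) (conj r (fstHalf y)))

instance (r : ℕ) : Mul (CayleyDickson r) := ⟨mul r⟩

instance (r : ℕ) : One (CayleyDickson r) := ⟨gen r 0⟩

/-- The real part, that is, the coefficient of `i_0 = 1`. -/
def re {r : ℕ} (z : CayleyDickson r) : ℝ := z.coord 0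

/-- Powers (the algebra is power associative, so the bracketing is immaterial). -/
def npow {r : ℕ} (z : CayleyDickson r) : ℕ → CayleyDickson r
  | 0 => 1
  | m + 1 => npow z m * z

/-- The exponential function, given by its power series. -/
def exp {r : ℕ} (z : CayleyDickson r) : CayleyDickson r :=
  ∑' m : ℕ, ((m.factorial : ℝ)⁻¹) • npow z m

/-- The `j`-th coordinate of `z` relative to the generators `N_j = φ i_j`. -/
def frameCoord {r : ℕ} (φ : CayleyDickson r ≃ₗ[ℝ] CayleyDickson r) (z : CayleyDickson r)
    (j : ℕ) : ℝ := (φ.symm z).coord j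

end CayleyDickson

namespace NoncommLaplace

open CayleyDickson

/-- The coordinates `t_1, …, t_n` of `t ∈ ℝ^n`, numbered from `1`, with `t_j = 0` for all
other `j`. -/
def tCoord {n : ℕ} (t : Fin n → ℝ) (j : ℕ) : ℝ :=
  if h : 1 ≤ j ∧ j ≤ n then t ⟨j - 1, by omega⟩ else 0

/-- `s_j = t_j + … + t_n`. -/
def tailSum {n : ℕ} (t : Fin n → ℝ) (j : ℕ) : ℝ := ∑ k ∈ Finset.Icc j n, tCoord t k

/-- The phase in Cartesian coordinates relative to the generators `N_j = φ i_j`: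
`u = p_0 (t_1 + … + t_n) + ∑_j p_j t_j N_j + ζ`. -/
def cartesianPhase {r n : ℕ} (φ : CayleyDickson r ≃ₗ[ℝ] CayleyDickson r)
    (p : CayleyDickson r) (t : Fin n → ℝ) (ζ : CayleyDickson r) : CayleyDickson r :=
  (frameCoord φ p 0 * tailSum t 1) • φ (gen r 0)
    + ∑ j ∈ Finset.Icc 1 (2 ^ r - 1), (frameCoord φ p j * tCoord t j) • φ (gen r j) + ζ

/-- The angle `p_j s_j + ζ_j`. -/
def angle {r n : ℕ} (φ : CayleyDickson r ≃ₗ[ℝ] CayleyDickson r)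
    (p : CayleyDickson r) (t : Fin n → ℝ) (ζ : CayleyDickson r) (j : ℕ) : ℝ :=
  frameCoord φ p j * tailSum t j + frameCoord φ ζ j

/-- The `k`-th component of the unit vector in spherical coordinates with angles `θ_2, …, θ_d`:
`sin θ_2 ⋯ sin θ_k cos θ_{k+1}` for `1 ≤ k < d`, and `sin θ_2 ⋯ sin θ_d` for `k = d`. -/
def sphericalDir (θ : ℕ → ℝ) (d k : ℕ) : ℝ :=
  (∏ l ∈ Finset.Icc 2 k, Real.sin (θ l)) * if k < d then Real.cos (θ (k + 1)) else 1

/-- The phase in spherical coordinates relative to the generators `N_j = φ i_j`: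
`u = p_0 s_1 + M + ζ_0`, where
`M = (p_1 s_1 + ζ_1) [N_1 cos θ_2 + N_2 sin θ_2 cos θ_3 + … + N_d sin θ_2 ⋯ sin θ_d]`,
`θ_j = p_j s_j + ζ_j` and `d = 2 ^ r - 1`. -/
def sphericalPhase {r n : ℕ} (φ : CayleyDickson r ≃ₗ[ℝ] CayleyDickson r)
    (p : CayleyDickson r) (t : Fin n → ℝ) (ζ : CayleyDickson r) : CayleyDickson r :=
  (frameCoord φ p 0 * tailSum t 1 + frameCoord φ ζ 0) • φ (gen r 0)
    + angle φ p t ζ 1 •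
      ∑ k ∈ Finset.Icc 1 (2 ^ r - 1),
        sphericalDir (angle φ p t ζ) (2 ^ r - 1) k • φ (gen r k)

/-- The multiparameter transform `∫ f(t) exp (-u(p, t; ζ)) dt` over `ℝ^n`. -/
def image {r n : ℕ}
    (u : CayleyDickson r → (Fin n → ℝ) → CayleyDickson r → CayleyDickson r)
    (f : (Fin n → ℝ) → CayleyDickson r) (p ζ : CayleyDickson r) : CayleyDickson r :=
  ∫ t : Fin n → ℝ, f t * CayleyDickson.exp (-(u p t ζ))

/-- The parameters admitted for functions of `n` variables: the coordinates relative to the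
generators `N_j = φ i_j` vanish for `j > n` (no restriction if `n = 2 ^ r - 1`). -/
def IsParameter {r : ℕ} (φ : CayleyDickson r ≃ₗ[ℝ] CayleyDickson r) (n : ℕ)
    (z : CayleyDickson r) : Prop :=
  ∀ j : ℕ, n < j → frameCoord φ z j = 0

/-- `f : ℝ^n → A_r` is an original with growth exponents `a` (in the positive directions)
and `b` (in the negative directions). -/
structure IsOriginal {r n : ℕ} (a b : ℝ) (f : (Fin n → ℝ) → CayleyDickson r) : Prop where
  ae_continuousAt : ∀ᵐ t : Fin n → ℝ, ContinuousAt f t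
  finite_discontinuities : ∀ (t : Fin n → ℝ) (j : Fin n) (c d : ℝ),
    {x ∈ Icc c d | ¬ ContinuousAt (fun y => f (Function.update t j y)) x}.Finite
  first_kind : ∀ (t : Fin n → ℝ) (j : Fin n) (x : ℝ),
    ¬ ContinuousAt (fun y => f (Function.update t j y)) x →
      (∃ l, Tendsto (fun y => f (Function.update t j y)) (𝓝[<] x) (𝓝 l)) ∧
      (∃ l, Tendsto (fun y => f (Function.update t j y)) (𝓝[>] x) (𝓝 l))
  holder : ∀ (t : Fin n → ℝ) (j : Fin n),
    ContinuousAt (fun y => f (Function.update t j y)) (t j) →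
      ∃ A : ℝ, 0 < A ∧ ∃ α : ℝ, 0 < α ∧ α ≤ 1 ∧ ∃ δ : ℝ, 0 < δ ∧ ∀ h : ℝ, |h| < δ →
        ‖f (Function.update t j (t j + h)) - f t‖ ≤ A * |h| ^ α
  growth : ∀ v : Fin n → ℝ, (∀ j, v j = 1 ∨ v j = -1) →
    ∃ C : ℝ, 0 < C ∧ ∀ t : Fin n → ℝ, (∀ j, 0 ≤ t j * v j) →
      ‖f t‖ < C * Real.exp (∑ j, (if v j = 1 then a else b) * t j)

end NoncommLaplace

end

/-! Fix one real number `a` in the common strip and let `p` have real part `a`. An automorphism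
preserves the unit, the real part and the exponential, so `φ.symm` turns equality of the images into
`∫ H(t) cis(m(t)) dt = 0`, where `H = φ.symm (e^{-a s_1} (f - g))` is integrable and `cis m = cos
‖m‖ + sinc ‖m‖ m` is the exponential of the imaginary part `m` of the negated phase
(`symm_image_eq`). It remains to extract the real Fourier transform of `H` from these integrals.

Cartesian phase: the norm in `cis` is not linear in `t`, but `‖R ω + y‖ - R` tends to `⟪ω, y⟫` as
`R` grows. Sending `ζ` to infinity along a unit vector `ω` in steps of `2π` gives, by dominated
convergence, `∫ H (cos + sin · ω)` at the linear angle `x + ξ · t`. Adding the same identity for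
`-ω` leaves the cosine (`ae_eq_zero_of_cartesian`).

Spherical phase: with `θ_j = 0` beyond `n`, the part of the exponential odd in `θ_n` is a multiple
of `sin θ_1 ⋯ sin θ_n` times the generator of index `n`. Generators are not zero divisors
(`mul_gen_eq_zero`), so `∫ (∏ sin θ_j) H = 0`; products of shifted sines span the characters
(`ae_eq_zero_of_spherical`).

Fourier uniqueness, applied coordinatewise, gives `H = 0` almost everywhere, hence at every point of
continuity. -/

namespace CayleyDickson

/-! ### Coordinates and the two halves of a doubled algebra. -/

variable {r : ℕ}

theorem coord_ofCoord (c : ℕ → ℝ) (j : ℕ) :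
    (ofCoord r c).coord j = if j < 2 ^ r then c j else 0 := by
  unfold coord ofCoord
  split_ifs <;> rfl

theorem coord_of_ge (z : CayleyDickson r) {j : ℕ} (h : 2 ^ r ≤ j) : z.coord j = 0 := by
  simp [coord, not_lt.2 h]

theorem ext_coord {x y : CayleyDickson r} (h : ∀ j < 2 ^ r, x.coord j = y.coord j) : x = y := by
  have : ∀ j : Fin (2 ^ r), (show EuclideanSpace ℝ (Fin (2 ^ r)) from x) j
      = (show EuclideanSpace ℝ (Fin (2 ^ r)) from y) j := by
    intro j
    have := h j j.2
    simpa [coord, j.2] using this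
  exact PiLp.ext (p := 2) this

@[simp] theorem coord_add (x y : CayleyDickson r) (j : ℕ) :
    (x + y).coord j = x.coord j + y.coord j := by
  unfold coord
  split_ifs
  · rfl
  · simp

@[simp] theorem coord_smul (a : ℝ) (x : CayleyDickson r) (j : ℕ) :
    (a • x).coord j = a * x.coord j := by
  unfold coord
  split_ifs
  · rfl
  · simp

/-- The coordinates as linear forms. -/
def coordₗ (r j : ℕ) : CayleyDickson r →ₗ[ℝ] ℝ where
  toFun z := z.coord j
  map_add' x y := coord_add x y j
  map_smul' a x := coord_smul a x j

theorem coordₗ_apply (z : CayleyDickson r) (j : ℕ) : coordₗ r j z = z.coord j := rfl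

@[simp] theorem coord_zero (j : ℕ) : (0 : CayleyDickson r).coord j = 0 := (coordₗ r j).map_zero

@[simp] theorem coord_neg (x : CayleyDickson r) (j : ℕ) : (-x).coord j = -x.coord j :=
  (coordₗ r j).map_neg x

@[simp] theorem coord_sub (x y : CayleyDickson r) (j : ℕ) :
    (x - y).coord j = x.coord j - y.coord j :=
  (coordₗ r j).map_sub x y

@[simp] theorem coord_sum {ι : Type*} (s : Finset ι) (x : ι → CayleyDickson r) (j : ℕ) :
    (∑ i ∈ s, x i).coord j = ∑ i ∈ s, (x i).coord j :=
  map_sum (coordₗ r j) x s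

theorem norm_sq_eq_sum (z : CayleyDickson r) :
    ‖z‖ ^ 2 = ∑ j ∈ Finset.range (2 ^ r), z.coord j ^ 2 := by
  have h := EuclideanSpace.norm_sq_eq (show EuclideanSpace ℝ (Fin (2 ^ r)) from z)
  rw [Finset.sum_range]
  refine h.trans (Finset.sum_congr rfl fun j _ => ?_)
  simp [coord, j.2]

theorem inner_eq_sum (x y : CayleyDickson r) :
    inner ℝ x y = ∑ j ∈ Finset.range (2 ^ r), x.coord j * y.coord j := by
  have h := PiLp.inner_apply (𝕜 := ℝ) (show EuclideanSpace ℝ (Fin (2 ^ r)) from x)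
    (show EuclideanSpace ℝ (Fin (2 ^ r)) from y)
  rw [Finset.sum_range]
  refine h.trans (Finset.sum_congr rfl fun j _ => ?_)
  simp [coord, j.2, mul_comm]

theorem two_pow_succ_eq (r : ℕ) : 2 ^ (r + 1) = 2 ^ r + 2 ^ r := by ring

@[simp] theorem coord_fstHalf (z : CayleyDickson (r + 1)) (j : ℕ) :
    (fstHalf z).coord j = if j < 2 ^ r then z.coord j else 0 := coord_ofCoord _ _

@[simp] theorem coord_sndHalf (z : CayleyDickson (r + 1)) (j : ℕ) :
    (sndHalf z).coord j = z.coord (2 ^ r + j) := by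
  rw [sndHalf, coord_ofCoord]
  split_ifs with h
  · rfl
  · rw [coord_of_ge]
    rw [two_pow_succ_eq]
    omega

@[simp] theorem coord_double (ξ η : CayleyDickson r) (j : ℕ) :
    (double ξ η).coord j = if j < 2 ^ r then ξ.coord j else η.coord (j - 2 ^ r) := by
  rw [double, coord_ofCoord, two_pow_succ_eq]
  split_ifs
  · rfl
  · rfl
  · omega
  · rw [coord_of_ge]
    omega

@[simp] theorem fstHalf_double (ξ η : CayleyDickson r) : fstHalf (double ξ η) = ξ :=
  ext_coord fun j hj => by simp [hj]

@[simp] theorem sndHalf_double (ξ η : CayleyDickson r) : sndHalf (double ξ η) = η :=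
  ext_coord fun j _ => by simp

@[simp] theorem double_halves (z : CayleyDickson (r + 1)) : double (fstHalf z) (sndHalf z) = z :=
  ext_coord fun j _ => by
    rw [coord_double, coord_fstHalf, coord_sndHalf]
    split_ifs with h
    · rfl
    · congr 1
      omega

theorem ext_halves {x y : CayleyDickson (r + 1)} (h₁ : fstHalf x = fstHalf y)
    (h₂ : sndHalf x = sndHalf y) : x = y := by
  rw [← double_halves x, h₁, h₂, double_halves]

@[simp] theorem fstHalf_add (x y : CayleyDickson (r + 1)) :
    fstHalf (x + y) = fstHalf x + fstHalf y := ext_coord fun j hj => by simp [hj]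

@[simp] theorem sndHalf_add (x y : CayleyDickson (r + 1)) :
    sndHalf (x + y) = sndHalf x + sndHalf y := ext_coord fun j _ => by simp

@[simp] theorem fstHalf_smul (a : ℝ) (x : CayleyDickson (r + 1)) :
    fstHalf (a • x) = a • fstHalf x := ext_coord fun j hj => by simp [hj]

@[simp] theorem sndHalf_smul (a : ℝ) (x : CayleyDickson (r + 1)) :
    sndHalf (a • x) = a • sndHalf x := ext_coord fun j _ => by simp

@[simp] theorem fstHalf_sub (x y : CayleyDickson (r + 1)) :
    fstHalf (x - y) = fstHalf x - fstHalf y := ext_coord fun j hj => by simp [hj]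

@[simp] theorem sndHalf_sub (x y : CayleyDickson (r + 1)) :
    sndHalf (x - y) = sndHalf x - sndHalf y := ext_coord fun j _ => by simp

theorem one_def : (1 : CayleyDickson r) = gen r 0 := rfl

theorem coord_gen (j k : ℕ) :
    (gen r j).coord k = if k = j ∧ k < 2 ^ r then 1 else 0 := by
  rw [gen, coord_ofCoord]
  by_cases h : k = j <;> simp [h]

theorem coord_one (k : ℕ) : (1 : CayleyDickson r).coord k = if k = 0 then 1 else 0 := by
  rw [one_def, coord_gen]
  have : 0 < 2 ^ r := by positivity
  split_ifs <;> simp_all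

theorem fstHalf_gen (j : ℕ) : fstHalf (gen (r + 1) j) = gen r j :=
  ext_coord fun k hk => by
    simp only [coord_fstHalf, coord_gen, two_pow_succ_eq]
    split_ifs <;> first | rfl | omega

theorem sndHalf_gen_of_lt {j : ℕ} (hj : j < 2 ^ r) : sndHalf (gen (r + 1) j) = 0 :=
  ext_coord fun k hk => by
    simp only [coord_sndHalf, coord_gen, two_pow_succ_eq, coord_zero]
    split_ifs <;> first | rfl | omega

theorem fstHalf_gen_of_ge {j : ℕ} (hj : 2 ^ r ≤ j) : fstHalf (gen (r + 1) j) = 0 :=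
  ext_coord fun k hk => by
    have : k ≠ j := by omega
    simp [coord_gen, this]

theorem sndHalf_gen_of_ge {j : ℕ} (hj : 2 ^ r ≤ j) :
    sndHalf (gen (r + 1) j) = gen r (j - 2 ^ r) :=
  ext_coord fun k hk => by
    simp only [coord_sndHalf, coord_gen, two_pow_succ_eq]
    split_ifs <;> first | rfl | omega

@[simp] theorem fstHalf_one : fstHalf (1 : CayleyDickson (r + 1)) = 1 :=
  fstHalf_gen 0

@[simp] theorem sndHalf_one : sndHalf (1 : CayleyDickson (r + 1)) = 0 :=
  sndHalf_gen_of_lt (by positivity)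

theorem re_eq_re_fstHalf (z : CayleyDickson (r + 1)) : z.re = (fstHalf z).re := by
  simp [re]

theorem norm_sq_eq_halves (z : CayleyDickson (r + 1)) :
    ‖z‖ ^ 2 = ‖fstHalf z‖ ^ 2 + ‖sndHalf z‖ ^ 2 := by
  rw [norm_sq_eq_sum, norm_sq_eq_sum, norm_sq_eq_sum, two_pow_succ_eq, Finset.sum_range_add]
  congr 1
  · exact Finset.sum_congr rfl fun j hj => by simp [Finset.mem_range.1 hj]
  · exact Finset.sum_congr rfl fun j hj => by simp

/-! ### Conjugation, the product, and its quadratic identity. -/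

theorem conj_eq (z : CayleyDickson r) : conj r z = (2 * z.re) • (1 : CayleyDickson r) - z := by
  induction r with
  | zero =>
    refine ext_coord fun j hj => ?_
    obtain rfl : j = 0 := by simpa using hj
    simp [conj, re, coord_one]
    ring
  | succ r ih => exact ext_halves (by simp [conj, ih, re_eq_re_fstHalf z]) (by simp [conj])

theorem re_one : (1 : CayleyDickson r).re = 1 := by simp [re, coord_one]

theorem norm_one : ‖(1 : CayleyDickson r)‖ = 1 := by
  have h : ‖(1 : CayleyDickson r)‖ ^ 2 = 1 := by
    rw [norm_sq_eq_sum, Finset.sum_eq_single 0]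
    · simp [coord_one]
    · intro j _ hj
      simp [coord_one, hj]
    · intro h
      simp at h
  nlinarith [norm_nonneg (1 : CayleyDickson r)]

theorem mul_zero_eq (x y : CayleyDickson 0) :
    x * y = ofCoord 0 fun j => x.coord j * y.coord j := rfl

@[simp] theorem fstHalf_mul (x y : CayleyDickson (r + 1)) :
    fstHalf (x * y) = fstHalf x * fstHalf y - conj r (sndHalf y) * sndHalf x :=
  fstHalf_double _ _

@[simp] theorem sndHalf_mul (x y : CayleyDickson (r + 1)) :
    sndHalf (x * y) = sndHalf y * fstHalf x + sndHalf x * conj r (fstHalf y) :=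
  sndHalf_double _ _

theorem conj_add (x y : CayleyDickson r) : conj r (x + y) = conj r x + conj r y := by
  simp only [conj_eq, re, coord_add]
  module

theorem conj_smul (a : ℝ) (x : CayleyDickson r) : conj r (a • x) = a • conj r x := by
  simp only [conj_eq, re, coord_smul]
  module

theorem conj_one : conj r (1 : CayleyDickson r) = 1 := by
  rw [conj_eq, re_one]
  module

/-- The doubling formula reverses the order of some factors, so each one-sided law uses both
one-sided laws of the smaller algebra; hence a joint induction. -/
theorem mul_bilinear : (∀ x y z : CayleyDickson r, (x + y) * z = x * z + y * z) ∧
    (∀ x y z : CayleyDickson r, x * (y + z) = x * y + x * z) ∧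
    (∀ (a : ℝ) (x y : CayleyDickson r), (a • x) * y = a • (x * y)) ∧
    (∀ (a : ℝ) (x y : CayleyDickson r), x * (a • y) = a • (x * y)) := by
  induction r with
  | zero =>
    refine ⟨?_, ?_, ?_, ?_⟩ <;> intros <;> refine ext_coord fun j hj => ?_ <;>
      simp only [mul_zero_eq, coord_ofCoord, coord_add, coord_smul, if_pos hj] <;> ring
  | succ r ih =>
    obtain ⟨h₁, h₂, h₃, h₄⟩ := ih
    refine ⟨?_, ?_, ?_, ?_⟩ <;> intros <;> refine ext_halves ?_ ?_ <;>
      simp only [fstHalf_mul, sndHalf_mul, fstHalf_add, sndHalf_add, fstHalf_smul, sndHalf_smul,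
        conj_add, conj_smul, h₁, h₂, h₃, h₄] <;> module

/-- The multiplication as a continuous bilinear map. -/
noncomputable def mulL (r : ℕ) : CayleyDickson r →L[ℝ] CayleyDickson r →L[ℝ] CayleyDickson r :=
  (LinearMap.mk₂ ℝ (fun x y : CayleyDickson r => x * y) mul_bilinear.1 mul_bilinear.2.2.1
    mul_bilinear.2.1 mul_bilinear.2.2.2).toContinuousBilinearMap

theorem mulL_apply (x y : CayleyDickson r) : mulL r x y = x * y := rfl

protected theorem add_mul (x y z : CayleyDickson r) : (x + y) * z = x * z + y * z :=
  mul_bilinear.1 x y z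

protected theorem mul_add (x y z : CayleyDickson r) : x * (y + z) = x * y + x * z :=
  mul_bilinear.2.1 x y z

protected theorem smul_mul (a : ℝ) (x y : CayleyDickson r) : (a • x) * y = a • (x * y) :=
  mul_bilinear.2.2.1 a x y

protected theorem mul_smul (a : ℝ) (x y : CayleyDickson r) : x * (a • y) = a • (x * y) :=
  mul_bilinear.2.2.2 a x y

protected theorem sub_mul (x y z : CayleyDickson r) : (x - y) * z = x * z - y * z := by
  simp [← mulL_apply]

protected theorem mul_sub (x y z : CayleyDickson r) : x * (y - z) = x * y - x * z :=
  (mulL r x).map_sub y z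

protected theorem zero_mul (x : CayleyDickson r) : 0 * x = 0 := by
  simp [← mulL_apply]

protected theorem mul_zero (x : CayleyDickson r) : x * 0 = 0 := (mulL r x).map_zero

protected theorem neg_mul (x y : CayleyDickson r) : -x * y = -(x * y) := by
  simp [← mulL_apply]

protected theorem mul_neg (x y : CayleyDickson r) : x * -y = -(x * y) := (mulL r x).map_neg y

@[simp] theorem conj_zero : conj r (0 : CayleyDickson r) = 0 := by
  simp [conj_eq, re]

theorem one_mul_and_mul_one :
    (∀ x : CayleyDickson r, 1 * x = x) ∧ ∀ x : CayleyDickson r, x * 1 = x := by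
  induction r with
  | zero =>
    refine ⟨?_, ?_⟩ <;> intro x <;> refine ext_coord fun j hj => ?_ <;>
      obtain rfl : j = 0 := by simpa using hj
    all_goals simp [mul_zero_eq, coord_ofCoord, coord_one]
  | succ r ih =>
    refine ⟨?_, ?_⟩ <;> intro x <;> refine ext_halves ?_ ?_ <;>
      simp [ih, conj_one, CayleyDickson.zero_mul, CayleyDickson.mul_zero]

protected theorem one_mul (x : CayleyDickson r) : 1 * x = x := one_mul_and_mul_one.1 x

protected theorem mul_one (x : CayleyDickson r) : x * 1 = x := one_mul_and_mul_one.2 x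

/-- After substituting `conj_eq`, the halves of `z * z` involve only squares of halves and a product
with a real multiple of `1`, so no associativity is needed. This identity yields both the closed
form of the exponential and the invariance of the real part. -/
theorem mul_self (z : CayleyDickson r) :
    z * z = (2 * z.re) • z - ‖z‖ ^ 2 • (1 : CayleyDickson r) := by
  induction r with
  | zero =>
    refine ext_coord fun j hj => ?_
    obtain rfl : j = 0 := by simpa using hj
    simp [mul_zero_eq, coord_ofCoord, coord_one, norm_sq_eq_sum, re]
    ring
  | succ r ih =>
    refine ext_halves ?_ ?_
    · simp only [fstHalf_mul, conj_eq, CayleyDickson.sub_mul, CayleyDickson.smul_mul,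
        CayleyDickson.one_mul, ih, fstHalf_sub, fstHalf_smul, fstHalf_one, norm_sq_eq_halves z,
        re_eq_re_fstHalf z]
      module
    · simp only [sndHalf_mul, conj_eq, CayleyDickson.mul_sub, CayleyDickson.mul_smul,
        CayleyDickson.mul_one, sndHalf_sub, sndHalf_smul, sndHalf_one, re_eq_re_fstHalf z]
      module

theorem mul_self_of_re_eq_zero {z : CayleyDickson r} (hz : z.re = 0) :
    z * z = -(‖z‖ ^ 2 • (1 : CayleyDickson r)) := by
  rw [mul_self, hz]
  module

theorem conj_injective : Function.Injective (conj r) := by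
  intro x y h
  have hre : ∀ z : CayleyDickson r, (conj r z).re = z.re := by
    intro z
    simp [conj_eq, re, coord_one]
    ring
  have h₀ : x.re = y.re := by rw [← hre x, h, hre]
  rw [conj_eq, conj_eq, h₀] at h
  exact sub_right_injective h

theorem conj_gen (j : ℕ) : conj r (gen r j) = gen r j ∨ conj r (gen r j) = -gen r j := by
  rcases eq_or_ne j 0 with rfl | hj
  · exact Or.inl conj_one
  · right
    simp [conj_eq, re, coord_gen, hj.symm]

/-- Zero divisors exist for large `r`, but a generator has one vanishing half, so multiplication by
it acts on the two halves of `x` separately, by a smaller generator up to conjugation. Left and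
right multiplication get exchanged, so both are treated together. -/
theorem mul_gen_eq_zero {j : ℕ} (hj : j < 2 ^ r) :
    (∀ x : CayleyDickson r, x * gen r j = 0 → x = 0) ∧
      ∀ x : CayleyDickson r, gen r j * x = 0 → x = 0 := by
  induction r generalizing j with
  | zero =>
    obtain rfl : j = 0 := by simpa using hj
    exact ⟨fun x hx => by rwa [← one_def, CayleyDickson.mul_one] at hx,
      fun x hx => by rwa [← one_def, CayleyDickson.one_mul] at hx⟩
  | succ r ih =>
    have hc {k : ℕ} (hk : k < 2 ^ r) : (∀ x : CayleyDickson r, x * conj r (gen r k) = 0 → x = 0) ∧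
        ∀ x : CayleyDickson r, conj r (gen r k) * x = 0 → x = 0 := by
      rcases conj_gen (r := r) k with h | h <;> rw [h]
      · exact ih hk
      · simpa only [CayleyDickson.mul_neg, CayleyDickson.neg_mul, neg_eq_zero] using ih hk
    have h0 {x : CayleyDickson r} (hx : conj r x = 0) : x = 0 :=
      conj_injective (hx.trans conj_zero.symm)
    have key {x : CayleyDickson (r + 1)} (h₁ : fstHalf x = 0) (h₂ : sndHalf x = 0) : x = 0 := by
      refine ext_halves ?_ ?_
      · rw [h₁]
        simpa using (fstHalf_smul 0 (0 : CayleyDickson (r + 1))).symm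
      · rw [h₂]
        simpa using (sndHalf_smul 0 (0 : CayleyDickson (r + 1))).symm
    have hz₁ : fstHalf (0 : CayleyDickson (r + 1)) = 0 := by
      simpa using fstHalf_smul 0 (0 : CayleyDickson (r + 1))
    have hz₂ : sndHalf (0 : CayleyDickson (r + 1)) = 0 := by
      simpa using sndHalf_smul 0 (0 : CayleyDickson (r + 1))
    rcases lt_or_ge j (2 ^ r) with h | h
    · refine ⟨fun x hx => ?_, fun x hx => ?_⟩ <;>
        have h₁ := congrArg fstHalf hx <;> have h₂ := congrArg sndHalf hx <;>
        simp only [fstHalf_mul, sndHalf_mul, fstHalf_gen, sndHalf_gen_of_lt h, conj_zero,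
          CayleyDickson.zero_mul, CayleyDickson.mul_zero, sub_zero, zero_add, add_zero, hz₁, hz₂]
          at h₁ h₂
      · exact key ((ih h).1 _ h₁) ((hc h).1 _ h₂)
      · exact key ((ih h).2 _ h₁) ((ih h).1 _ h₂)
    · have h' : j - 2 ^ r < 2 ^ r := by
        rw [two_pow_succ_eq] at hj
        omega
      refine ⟨fun x hx => ?_, fun x hx => ?_⟩ <;>
        have h₁ := congrArg fstHalf hx <;> have h₂ := congrArg sndHalf hx <;>
        simp only [fstHalf_mul, sndHalf_mul, fstHalf_gen_of_ge h, sndHalf_gen_of_ge h, conj_zero,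
          CayleyDickson.zero_mul, CayleyDickson.mul_zero, zero_sub, zero_add, add_zero, hz₁, hz₂,
          neg_eq_zero] at h₁ h₂
      · exact key ((ih h').2 _ h₂) ((hc h').2 _ h₁)
      · exact key (h0 ((ih h').2 _ h₂)) (h0 ((ih h').1 _ h₁))

/-! ### Multiplicative linear bijections preserve unit, real part and exponential. -/

section Automorphism

variable (φ : CayleyDickson r ≃ₗ[ℝ] CayleyDickson r)

theorem map_one_of_mul (hφ : ∀ x y, φ (x * y) = φ x * φ y) : φ 1 = 1 := by
  have h := hφ (φ.symm 1) 1
  rwa [CayleyDickson.mul_one, φ.apply_symm_apply, CayleyDickson.one_mul, eq_comm] at h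

/-- The square of `φ v` is real, so by `mul_self` a nonzero real part would make `φ v` a real
multiple of `1`; then `v` is the same multiple, which is `0` because `v` is imaginary. -/
theorem re_map_of_re_eq_zero (hφ : ∀ x y, φ (x * y) = φ x * φ y)
    {v : CayleyDickson r} (hv : v.re = 0) : (φ v).re = 0 := by
  by_contra hne
  have h := hφ v v
  rw [mul_self_of_re_eq_zero hv, map_neg, map_smul, map_one_of_mul φ hφ, mul_self] at h
  have h1 : φ v = ((‖φ v‖ ^ 2 - ‖v‖ ^ 2) / (2 * (φ v).re)) • (1 : CayleyDickson r) := by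
    have h2 : (2 * (φ v).re) • φ v = (‖φ v‖ ^ 2 - ‖v‖ ^ 2) • (1 : CayleyDickson r) := by
      rw [sub_smul, ← sub_eq_zero]
      rw [← sub_eq_zero] at h
      rw [← neg_eq_zero, ← h]
      module
    rw [div_eq_inv_mul, mul_smul, ← h2, smul_smul, inv_mul_cancel₀ (by simpa using hne), one_smul]
  have h3 : v = ((‖φ v‖ ^ 2 - ‖v‖ ^ 2) / (2 * (φ v).re)) • (1 : CayleyDickson r) := by
    apply φ.injective
    rw [map_smul, map_one_of_mul φ hφ]
    exact h1
  have h4 := congrArg re h3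
  apply hne
  rw [h1, ← h4, hv]

theorem re_map (hφ : ∀ x y, φ (x * y) = φ x * φ y) (x : CayleyDickson r) :
    (φ x).re = x.re := by
  have h : (x - x.re • (1 : CayleyDickson r)).re = 0 := by
    simp [re, coord_one]
  have h' := re_map_of_re_eq_zero φ hφ h
  rw [map_sub, map_smul, map_one_of_mul φ hφ] at h'
  simp only [re, coord_sub, coord_smul, coord_one] at h' ⊢
  simp at h'
  linarith

theorem symm_mul (hφ : ∀ x y, φ (x * y) = φ x * φ y)
    (x y : CayleyDickson r) : φ.symm (x * y) = φ.symm x * φ.symm y := by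
  apply φ.injective
  simp [hφ]

theorem map_npow (hφ : ∀ x y, φ (x * y) = φ x * φ y)
    (z : CayleyDickson r) (k : ℕ) : φ (npow z k) = npow (φ z) k := by
  induction k with
  | zero => exact map_one_of_mul φ hφ
  | succ k ih => simp only [npow, hφ, ih]

theorem map_exp (hφ : ∀ x y, φ (x * y) = φ x * φ y)
    (z : CayleyDickson r) : φ (exp z) = exp (φ z) := by
  have h := φ.toContinuousLinearEquiv.map_tsum (f := fun m : ℕ => ((m.factorial : ℝ)⁻¹) • npow z m)
    (L := SummationFilter.unconditional ℕ)
  refine h.trans (tsum_congr fun k => ?_)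
  simp [map_npow φ hφ]

end Automorphism

/-! ### Closed form of the exponential. -/

/-- The exponential of a purely imaginary element, in closed form. -/
noncomputable def cis (m : CayleyDickson r) : CayleyDickson r :=
  Real.cos ‖m‖ • (1 : CayleyDickson r) + Real.sinc ‖m‖ • m

/-- The plane spanned by `1` and `e` is the image of `ℂ` under a continuous linear multiplicative
map, which carries the complex exponential series over term by term. -/
theorem exp_of_sq_eq_neg_one {e : CayleyDickson r} (he : e * e = -1) (a b : ℝ) :
    exp (a • (1 : CayleyDickson r) + b • e) =
      Real.exp a • (Real.cos b • (1 : CayleyDickson r) + Real.sin b • e) := by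
  let ι : ℂ →L[ℝ] CayleyDickson r :=
    Complex.reCLM.smulRight (1 : CayleyDickson r) + Complex.imCLM.smulRight e
  have hι (w : ℂ) : ι w = w.re • (1 : CayleyDickson r) + w.im • e := rfl
  have hmul (w w' : ℂ) : ι w * ι w' = ι (w * w') := by
    simp only [hι, CayleyDickson.add_mul, CayleyDickson.mul_add, CayleyDickson.smul_mul,
      CayleyDickson.mul_smul, CayleyDickson.one_mul, CayleyDickson.mul_one, he, Complex.mul_re,
      Complex.mul_im]
    module
  have hpow (w : ℂ) (k : ℕ) : npow (ι w) k = ι (w ^ k) := by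
    induction k with
    | zero => simp [npow, hι]
    | succ k ih => rw [npow, ih, hmul, pow_succ]
  have hexp (w : ℂ) : exp (ι w) = ι (Complex.exp w) := by
    have h := NormedSpace.exp_series_hasSum_exp' (𝕂 := ℝ) w
    rw [← Complex.exp_eq_exp_ℂ] at h
    rw [← (ι.hasSum h).tsum_eq]
    exact tsum_congr fun k => by rw [hpow, map_smul]
  have h := hexp (⟨a, b⟩ : ℂ)
  rw [hι, hι, Complex.exp_re, Complex.exp_im] at h
  rw [h]
  simp only
  module

theorem re_gen_one (hr : 1 ≤ r) : (gen r 1).re = 0 ∧ ‖gen r 1‖ = 1 := by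
  have h2 : 1 < 2 ^ r := Nat.one_lt_two_pow (by omega)
  refine ⟨by simp [re, coord_gen], ?_⟩
  have h : ‖gen r 1‖ ^ 2 = 1 := by
    rw [norm_sq_eq_sum, Finset.sum_eq_single 1]
    · simp [coord_gen, h2]
    · intro j _ hj
      simp [coord_gen, hj]
    · simp [h2]
  nlinarith [norm_nonneg (gen r 1)]

theorem exp_eq_cis (hr : 1 ≤ r) (a : ℝ) {m : CayleyDickson r} (hm : m.re = 0) :
    exp (a • (1 : CayleyDickson r) + m) = Real.exp a • cis m := by
  rcases eq_or_ne m 0 with rfl | hne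
  -- With `m = 0` there is no direction to normalise; any square root of `-1` serves, and one exists
  -- because `1 ≤ r`.
  · have he : gen r 1 * gen r 1 = -1 := by
      rw [mul_self_of_re_eq_zero (re_gen_one hr).1, (re_gen_one hr).2]
      simp
    simpa [cis] using exp_of_sq_eq_neg_one he a 0
  · have hn : ‖m‖ ≠ 0 := norm_ne_zero_iff.2 hne
    have he : (‖m‖⁻¹ • m) * (‖m‖⁻¹ • m) = -1 := by
      rw [CayleyDickson.smul_mul, CayleyDickson.mul_smul, mul_self_of_re_eq_zero hm, smul_neg,
        smul_neg, smul_smul, smul_smul]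
      rw [show ‖m‖⁻¹ * ‖m‖⁻¹ * ‖m‖ ^ 2 = 1 by field_simp, one_smul]
    have h := exp_of_sq_eq_neg_one he a ‖m‖
    rw [smul_smul, smul_smul, mul_inv_cancel₀ hn, one_smul] at h
    rw [h, cis, Real.sinc_of_ne_zero hn, div_eq_mul_inv]

theorem continuous_cis : Continuous (cis : CayleyDickson r → CayleyDickson r) := by
  unfold cis
  have := Real.continuous_sinc
  fun_prop

theorem norm_cis_le (m : CayleyDickson r) : ‖cis m‖ ≤ 2 := by
  have h1 : ‖Real.cos ‖m‖ • (1 : CayleyDickson r)‖ ≤ 1 := by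
    rw [norm_smul, norm_one, mul_one]
    exact Real.abs_cos_le_one _
  have h2 : ‖Real.sinc ‖m‖ • m‖ ≤ 1 := by
    rw [norm_smul]
    rcases eq_or_ne m 0 with rfl | hne
    · simp
    · have hn : 0 < ‖m‖ := norm_pos_iff.2 hne
      rw [Real.sinc_of_ne_zero hn.ne', Real.norm_eq_abs, abs_div, abs_of_pos hn,
        div_mul_cancel₀ _ hn.ne']
      exact Real.abs_sin_le_one _
  exact (norm_add_le _ _).trans (by linarith)

theorem cis_smul_of_norm_eq_one {v : CayleyDickson r} (hv : ‖v‖ = 1) (θ : ℝ) :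
    cis (θ • v) = Real.cos θ • (1 : CayleyDickson r) + Real.sin θ • v := by
  rw [cis, norm_smul, hv, mul_one, Real.norm_eq_abs, Real.cos_abs, smul_smul]
  congr 2
  rcases eq_or_ne θ 0 with rfl | h
  · simp
  · rw [Real.sinc_of_ne_zero (abs_ne_zero.2 h)]
    rcases abs_choice θ with h' | h' <;> rw [h']
    · field_simp
    · rw [Real.sin_neg]
      field_simp

end CayleyDickson

namespace NoncommLaplace

open CayleyDickson

variable {r n : ℕ}

/-! ### Linear forms in the coordinates `t_j` and in the tail sums `s_j`. -/

section Coordinates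

theorem continuous_tCoord (j : ℕ) : Continuous fun t : Fin n → ℝ => tCoord t j := by
  unfold tCoord
  split_ifs <;> fun_prop

theorem continuous_tailSum (j : ℕ) : Continuous fun t : Fin n → ℝ => tailSum t j :=
  continuous_finsetSum _ fun k _ => continuous_tCoord k

theorem tCoord_of_notMem (t : Fin n → ℝ) {j : ℕ} (hj : j ∉ Finset.Icc 1 n) : tCoord t j = 0 :=
  dif_neg fun h => hj (Finset.mem_Icc.2 h)

theorem sum_Icc_tCoord_mul_tCoord (ξ t : Fin n → ℝ) :
    ∑ j ∈ Finset.Icc 1 n, tCoord ξ j * tCoord t j = ∑ j, ξ j * t j := by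
  rw [← Finset.sum_bij (s := (Finset.univ : Finset (Fin n))) (f := fun j => ξ j * t j)
    (fun (j : Fin n) _ => (j : ℕ) + 1)]
  · intro j _
    rw [Finset.mem_Icc]
    omega
  · intro i _ j _ h
    exact Fin.ext (by omega)
  · intro j hj
    rw [Finset.mem_Icc] at hj
    exact ⟨⟨j - 1, by omega⟩, Finset.mem_univ _, by simp; omega⟩
  · intro j _
    have h : 1 ≤ (j : ℕ) + 1 ∧ (j : ℕ) + 1 ≤ n := by omega
    simp only [tCoord, dif_pos h]
    rfl

theorem tailSum_one (t : Fin n → ℝ) : tailSum t 1 = ∑ j, t j := by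
  have h := sum_Icc_tCoord_mul_tCoord (fun _ => 1) t
  simp only [one_mul] at h
  rw [tailSum, ← h]
  refine Finset.sum_congr rfl fun j hj => ?_
  rw [tCoord, tCoord, dif_pos (Finset.mem_Icc.1 hj), dif_pos (Finset.mem_Icc.1 hj), one_mul]

/-- Abel summation; the convention `tCoord ξ 0 = 0` makes the term `j = 1` correct. It lets every
frequency be realised by the spherical angles. -/
theorem sum_sub_mul_tailSum (ξ t : Fin n → ℝ) :
    ∑ j ∈ Finset.Icc 1 n, (tCoord ξ j - tCoord ξ (j - 1)) * tailSum t j = ∑ j, ξ j * t j := by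
  rw [← sum_Icc_tCoord_mul_tCoord]
  simp only [tailSum, Finset.mul_sum]
  rw [Finset.sum_comm' (t' := Finset.Icc 1 n) (s' := fun k => Finset.Icc 1 k)
    (by intro x y; simp only [Finset.mem_Icc]; omega)]
  refine Finset.sum_congr rfl fun k _ => ?_
  rw [← Finset.sum_mul]
  congr 1
  clear * -
  induction k with
  | zero => simp [tCoord]
  | succ k ih =>
    rw [Finset.sum_Icc_succ_top (by omega), ih]
    simp

end Coordinates

/-! ### Fourier uniqueness, from characters to cosines and products of sines. -/

section Uniqueness

/-- An integrable function on `ℝ^n` with vanishing Fourier transform vanishes a.e. -/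
theorem ae_eq_zero_of_integral_cexp_eq_zero {h : (Fin n → ℝ) → ℝ} (hh : Integrable h)
    (H : ∀ ξ : Fin n → ℝ,
      ∫ t, Complex.exp (((∑ j, ξ j * t j : ℝ) : ℂ) * Complex.I) * (h t : ℂ) = 0) :
    h =ᵐ[volume] 0 := by
  set μ := (volume : Measure (Fin n → ℝ)).withDensity fun t => ENNReal.ofReal (h t) with hμ
  set ν := (volume : Measure (Fin n → ℝ)).withDensity fun t => ENNReal.ofReal (-h t) with hν
  have : IsFiniteMeasure μ := isFiniteMeasure_withDensity_ofReal hh.2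
  have : IsFiniteMeasure ν := isFiniteMeasure_withDensity_ofReal hh.neg.2
  have hm₁ : AEMeasurable (fun t => ENNReal.ofReal (h t)) := hh.aemeasurable.ennreal_ofReal
  have hm₂ : AEMeasurable (fun t => ENNReal.ofReal (-h t)) := hh.neg.aemeasurable.ennreal_ofReal
  have hpos (x : ℝ) : max 0 x - max 0 (-x) = x := by
    rw [max_comm, max_comm 0]
    exact max_zero_sub_max_neg_zero_eq_self x
  -- The positive and negative parts of `h` are densities of finite measures; the hypothesis says
  -- that their characteristic functions agree.
  have hμν : μ = ν := by
    refine Measure.ext_of_charFunDual (funext fun L => ?_)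
    have hL : ∀ t : Fin n → ℝ, L t = ∑ j, L (Pi.single j 1) * t j := by
      intro t
      conv_lhs => rw [pi_eq_sum_univ' t]
      rw [map_sum]
      refine Finset.sum_congr rfl fun j _ => ?_
      rw [map_smul, smul_eq_mul, mul_comm]
    have hbdd {k : (Fin n → ℝ) → ℝ} (hk : Integrable k) :
        Integrable fun t => k t • Complex.exp ((L t : ℂ) * Complex.I) := by
      refine Integrable.mono' hk.norm ?_ (Eventually.of_forall fun t => ?_)
      · exact hk.aestronglyMeasurable.smul (by fun_prop : Continuous _).aestronglyMeasurable
      · rw [norm_smul, Complex.norm_exp_ofReal_mul_I, mul_one]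
    rw [charFunDual_apply, charFunDual_apply,
      integral_withDensity_eq_integral_toReal_smul₀ hm₁ (by simp),
      integral_withDensity_eq_integral_toReal_smul₀ hm₂ (by simp), ← sub_eq_zero,
      ← integral_sub]
    · rw [← H fun j => L (Pi.single j 1)]
      refine integral_congr_ae (Eventually.of_forall fun t => ?_)
      simp only
      rw [← hL, ← sub_smul, ENNReal.toReal_ofReal', ENNReal.toReal_ofReal', max_comm (-h t),
        max_comm (h t), hpos, Complex.real_smul, mul_comm]
    · refine hbdd ?_
      simp only [ENNReal.toReal_ofReal']
      exact hh.pos_part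
    · refine hbdd ?_
      simp only [ENNReal.toReal_ofReal']
      exact hh.neg_part
  rw [hμ, hν, withDensity_eq_iff_of_sigmaFinite hm₁ hm₂] at hμν
  filter_upwards [hμν] with t ht
  have := congrArg ENNReal.toReal ht
  rw [ENNReal.toReal_ofReal', ENNReal.toReal_ofReal'] at this
  rw [← hpos (h t), max_comm 0, max_comm 0, this, sub_self]
  rfl

theorem integrable_smul_of_abs_le_one {E : Type*} [NormedAddCommGroup E] [NormedSpace ℝ E]
    {H : (Fin n → ℝ) → E} (hH : Integrable H) {c : (Fin n → ℝ) → ℝ} (hc : Continuous c)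
    (hc1 : ∀ t, |c t| ≤ 1) : Integrable fun t => c t • H t :=
  hH.bdd_smul 1 hc.aestronglyMeasurable (Eventually.of_forall hc1)

theorem ae_eq_zero_of_coord {H : (Fin n → ℝ) → CayleyDickson r}
    (h : ∀ k, (fun t => (H t).coord k) =ᵐ[volume] 0) : H =ᵐ[volume] 0 := by
  filter_upwards [ae_all_iff.2 h] with t ht
  exact ext_coord fun k _ => by simpa using ht k

theorem integrable_coord {H : (Fin n → ℝ) → CayleyDickson r} (hH : Integrable H) (k : ℕ) :
    Integrable fun t => (H t).coord k :=
  (coordₗ r k).toContinuousLinearMap.integrable_comp hH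

theorem integral_smul_coord {H : (Fin n → ℝ) → CayleyDickson r} (c : (Fin n → ℝ) → ℝ)
    (hH : Integrable fun t => c t • H t) (k : ℕ) (h0 : ∫ t, c t • H t = 0) :
    ∫ t, c t * (H t).coord k = 0 := by
  have h := (coordₗ r k).toContinuousLinearMap.integral_comp_comm hH
  rw [h0, map_zero] at h
  simpa [coordₗ_apply] using h

theorem integral_ofReal_mul {c h : (Fin n → ℝ) → ℝ} (h0 : ∫ t, c t * h t = 0) :
    ∫ t, ((c t : ℂ) * (h t : ℂ)) = 0 := by
  simp only [← Complex.ofReal_mul]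
  rw [integral_complex_ofReal, h0, Complex.ofReal_zero]

theorem ae_eq_zero_of_integral_cos_eq_zero {H : (Fin n → ℝ) → CayleyDickson r}
    (hH : Integrable H)
    (h : ∀ (x : ℝ) (ξ : Fin n → ℝ), ∫ t, Real.cos (x + ∑ j, ξ j * t j) • H t = 0) :
    H =ᵐ[volume] 0 := by
  refine ae_eq_zero_of_coord fun k => ae_eq_zero_of_integral_cexp_eq_zero (integrable_coord hH k)
    fun ξ => ?_
  have hi (x : ℝ) : Integrable fun t => Real.cos (x + ∑ j, ξ j * t j) • H t :=
    integrable_smul_of_abs_le_one hH (by fun_prop) fun t => Real.abs_cos_le_one _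
  have h1 (x : ℝ) := integral_ofReal_mul (integral_smul_coord _ (hi x) k (h x ξ))
  have hi' (x : ℝ) : Integrable fun t =>
      ((Real.cos (x + ∑ j, ξ j * t j) : ℂ) * ((H t).coord k : ℂ)) := by
    simp only [← Complex.ofReal_mul]
    exact (integrable_coord (hi x) k).ofReal.congr (Eventually.of_forall fun t => by simp)
  -- The free shift `x` supplies the sine as well: `x = 0` gives the real part and `x = -π/2` the
  -- imaginary part of the character.
  have h2 : ∀ t, Complex.exp (((∑ j, ξ j * t j : ℝ) : ℂ) * Complex.I) * ((H t).coord k : ℂ) =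
      (Real.cos (0 + ∑ j, ξ j * t j) : ℂ) * ((H t).coord k : ℂ) +
      Complex.I * ((Real.cos (-(Real.pi / 2) + ∑ j, ξ j * t j) : ℂ) * ((H t).coord k : ℂ)) := by
    intro t
    rw [Complex.exp_mul_I, zero_add, ← Complex.ofReal_cos, ← Complex.ofReal_sin, neg_add_eq_sub,
      Real.cos_sub_pi_div_two]
    ring
  simp only [h2]
  rw [integral_add (hi' 0) ((hi' _).const_mul _), integral_const_mul, h1, h1]
  simp

theorem ae_eq_zero_of_integral_prod_sin_eq_zero {H : (Fin n → ℝ) → CayleyDickson r}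
    (hH : Integrable H)
    (h : ∀ c d : ℕ → ℝ,
      ∫ t, (∏ j ∈ Finset.Icc 1 n, Real.sin (c j * tailSum t j + d j)) • H t = 0) :
    H =ᵐ[volume] 0 := by
  refine ae_eq_zero_of_coord fun k => ae_eq_zero_of_integral_cexp_eq_zero (integrable_coord hH k)
    fun ξ => ?_
  have hi (c d : ℕ → ℝ) : Integrable fun t =>
      (∏ j ∈ Finset.Icc 1 n, Real.sin (c j * tailSum t j + d j)) • H t := by
    refine integrable_smul_of_abs_le_one hH ?_ fun t => ?_
    · have := continuous_tailSum (n := n)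
      fun_prop
    · rw [Finset.abs_prod]
      exact Finset.prod_le_one (fun _ _ => abs_nonneg _) fun _ _ => Real.abs_sin_le_one _
  have h1 (c d : ℕ → ℝ) := integral_ofReal_mul (integral_smul_coord _ (hi c d) k (h c d))
  have hi' (c d : ℕ → ℝ) : Integrable fun t =>
      (((∏ j ∈ Finset.Icc 1 n, Real.sin (c j * tailSum t j + d j) : ℝ) : ℂ) *
        ((H t).coord k : ℂ)) := by
    simp only [← Complex.ofReal_mul]
    exact (integrable_coord (hi c d) k).ofReal.congr (Eventually.of_forall fun t => by simp)
  set c : ℕ → ℝ := fun j => tCoord ξ j - tCoord ξ (j - 1)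
  -- The character is `∏ (cos + I sin)` over the angles `c j * tailSum t j`. On expanding, `T`
  -- collects the cosine factors, each a sine shifted by `π/2`.
  have h2 : ∀ t, Complex.exp (((∑ j, ξ j * t j : ℝ) : ℂ) * Complex.I) * ((H t).coord k : ℂ) =
      ∑ T ∈ (Finset.Icc 1 n).powerset, Complex.I ^ (Finset.Icc 1 n \ T).card *
        (((∏ j ∈ Finset.Icc 1 n,
          Real.sin (c j * tailSum t j + if j ∈ T then Real.pi / 2 else 0) : ℝ) : ℂ) *
            ((H t).coord k : ℂ)) := by
    intro t
    have h3 (j : ℕ) : Complex.exp (((c j * tailSum t j : ℝ) : ℂ) * Complex.I) =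
        (Real.sin (c j * tailSum t j + Real.pi / 2) : ℂ) +
          Complex.I * (Real.sin (c j * tailSum t j + 0) : ℂ) := by
      rw [Complex.exp_mul_I, Real.sin_add_pi_div_two, add_zero, Complex.ofReal_cos,
        Complex.ofReal_sin]
      ring
    rw [← sum_sub_mul_tailSum, Complex.ofReal_sum, Finset.sum_mul, Complex.exp_sum,
      Finset.prod_congr rfl fun j _ => h3 j, Finset.prod_add, Finset.sum_mul]
    refine Finset.sum_congr rfl fun T hT => ?_
    have h4 : (∏ j ∈ Finset.Icc 1 n,
        Real.sin (c j * tailSum t j + if j ∈ T then Real.pi / 2 else 0)) =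
        (∏ j ∈ Finset.Icc 1 n \ T, Real.sin (c j * tailSum t j + 0)) *
          ∏ j ∈ T, Real.sin (c j * tailSum t j + Real.pi / 2) := by
      rw [← Finset.prod_sdiff (Finset.mem_powerset.1 hT)]
      congr 1
      · exact Finset.prod_congr rfl fun j hj => by rw [if_neg (Finset.mem_sdiff.1 hj).2]
      · exact Finset.prod_congr rfl fun j hj => by rw [if_pos hj]
    rw [h4, Finset.prod_mul_distrib, Finset.prod_const, Complex.ofReal_mul, Complex.ofReal_prod,
      Complex.ofReal_prod]
    ring
  simp only [h2]
  rw [integral_finsetSum _ fun T _ => (hi' _ _).const_mul _]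
  refine Finset.sum_eq_zero fun T _ => ?_
  rw [integral_const_mul, h1, mul_zero]

/-- A function vanishing a.e. vanishes at its points of continuity. -/
theorem eq_zero_of_ae_eq_zero_of_continuousAt {E : Type*} [NormedAddCommGroup E]
    {h : (Fin n → ℝ) → E} (h0 : h =ᵐ[volume] 0) {t : Fin n → ℝ} (ht : ContinuousAt h t) :
    h t = 0 := by
  by_contra hne
  have h1 : ∀ᶠ s in 𝓝 t, h s ≠ 0 := ht.eventually_ne hne
  have h2 : volume {s | h s ≠ 0} = 0 := h0
  exact (Measure.measure_pos_of_mem_nhds volume h1).ne' h2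

end Uniqueness

/-! ### Measurability and integrability of originals. -/

section Originals

theorem IsOriginal.aestronglyMeasurable {a b : ℝ} {f : (Fin n → ℝ) → CayleyDickson r}
    (hf : IsOriginal a b f) : AEStronglyMeasurable f volume := by
  have hs : MeasurableSet {t | ContinuousAt f t} := measurableSet_of_continuousAt f
  have hc : ContinuousOn f {t | ContinuousAt f t} := fun t ht => ContinuousAt.continuousWithinAt ht
  have h := hc.aestronglyMeasurable (μ := volume) hs
  rwa [Measure.restrict_eq_self_of_ae_mem (s := {t | ContinuousAt f t}) hf.ae_continuousAt] at h

theorem integrable_exp_neg_mul_abs {δ : ℝ} (hδ : 0 < δ) :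
    Integrable fun x : ℝ => Real.exp (-(δ * |x|)) := by
  rw [← integrableOn_univ, ← Iic_union_Ioi (a := (0 : ℝ)), integrableOn_union]
  constructor
  · refine (integrableOn_exp_mul_Iic hδ 0).congr_fun (fun x hx => ?_) measurableSet_Iic
    simp only [abs_of_nonpos (mem_Iic.1 hx)]
    ring_nf
  · refine (integrableOn_exp_mul_Ioi (neg_lt_zero.2 hδ) 0).congr_fun (fun x hx => ?_)
      measurableSet_Ioi
    simp only [abs_of_pos (mem_Ioi.1 hx)]
    ring_nf

/-- On each orthant the growth bound beats the weight in every coordinate, giving domination by a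
multiple of `exp (-δ ∑ |t_j|)`. -/
theorem IsOriginal.integrable_exp_smul {a b : ℝ} {f : (Fin n → ℝ) → CayleyDickson r}
    (hf : IsOriginal a b f) {p : ℝ} (hap : a < p) (hpb : p < b) :
    Integrable fun t => Real.exp (-(p * tailSum t 1)) • f t := by
  choose C hC0 hC using fun s : Fin n → Bool =>
    hf.growth (fun j => if s j then 1 else -1) fun j => by cases s j <;> simp
  set δ := min (p - a) (b - p) with hδ
  have hδ0 : 0 < δ := lt_min (by linarith) (by linarith)
  have hg : Integrable fun t : Fin n → ℝ => (∑ s, C s) * ∏ j, Real.exp (-(δ * |t j|)) :=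
    (Integrable.fintype_prod fun _ => integrable_exp_neg_mul_abs hδ0).const_mul _
  refine hg.mono' ?_ (Eventually.of_forall fun t => ?_)
  · have := continuous_tailSum (n := n) 1
    exact (by fun_prop : Continuous fun t : Fin n → ℝ =>
      Real.exp (-(p * tailSum t 1))).aestronglyMeasurable.smul hf.aestronglyMeasurable
  · set s : Fin n → Bool := fun j => decide (0 ≤ t j) with hs
    have h1 := (hC s t fun j => by
      by_cases h : 0 ≤ t j
      · simp [hs, h]
      · simp [hs, h, (not_le.1 h).le]).le
    rw [norm_smul, Real.norm_eq_abs, abs_of_pos (Real.exp_pos _)]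
    -- The sum over all orthants replaces the orthant-dependent constant by a single one.
    have h2 : C s ≤ ∑ s, C s :=
      Finset.single_le_sum (fun s _ => (hC0 s).le) (Finset.mem_univ s)
    calc Real.exp (-(p * tailSum t 1)) * ‖f t‖
        ≤ Real.exp (-(p * tailSum t 1)) * (C s *
            Real.exp (∑ j, (if (if s j then (1 : ℝ) else -1) = 1 then a else b) * t j)) := by
          gcongr
      _ = C s * Real.exp (∑ j, ((if (if s j then (1 : ℝ) else -1) = 1 then a else b) - p) * t j) := by
          rw [mul_left_comm, ← Real.exp_add, tailSum_one, Finset.mul_sum, ← Finset.sum_neg_distrib,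
            ← Finset.sum_add_distrib]
          congr 2
          exact Finset.sum_congr rfl fun j _ => by ring
      _ ≤ (∑ s, C s) * ∏ j, Real.exp (-(δ * |t j|)) := by
          rw [← Real.exp_sum]
          gcongr with j
          · exact (hC0 s).le.trans h2
          · by_cases h : 0 ≤ t j
            · have : δ ≤ p - a := min_le_left _ _
              simp only [hs, h, decide_true, if_true, abs_of_nonneg h]
              nlinarith
            · have : δ ≤ b - p := min_le_right _ _
              have h' := (not_le.1 h).le
              simp only [hs, h, decide_false, abs_of_nonpos h']
              norm_num
              nlinarith

theorem integrable_mul_of_bounded {H : (Fin n → ℝ) → CayleyDickson r} (hH : Integrable H)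
    {E : (Fin n → ℝ) → CayleyDickson r} (hE : Continuous E) {C : ℝ} (hC : ∀ t, ‖E t‖ ≤ C) :
    Integrable fun t => H t * E t :=
  (mulL r).integrable_of_bilin_of_bdd_right C hH hE.aestronglyMeasurable (Eventually.of_forall hC)

theorem integral_mul_const {H : (Fin n → ℝ) → CayleyDickson r} (hH : Integrable H)
    (x : CayleyDickson r) : ∫ t, H t * x = (∫ t, H t) * x :=
  ((mulL r).flip x).integral_comp_comm hH

end Originals

end NoncommLaplace

/-! ### Transport of the image by `φ.symm`. -/

namespace NoncommLaplace

open CayleyDickson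

variable {r n : ℕ}

/-- The image, transported by `φ⁻¹`, for a phase whose transported negative is the sum of a real
part `-p_0 s_1` and a purely imaginary part `m`. -/
theorem symm_image_eq (hr : 1 ≤ r) (φ : CayleyDickson r ≃ₗ[ℝ] CayleyDickson r)
    (hφ : ∀ x y, φ (x * y) = φ x * φ y)
    (u : CayleyDickson r → (Fin n → ℝ) → CayleyDickson r → CayleyDickson r)
    (f : (Fin n → ℝ) → CayleyDickson r) (p ζ : CayleyDickson r) (a : ℝ)
    (m : (Fin n → ℝ) → CayleyDickson r) (hm : ∀ t, (m t).re = 0)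
    (hu : ∀ t, u p t ζ = φ ((a * tailSum t 1) • (1 : CayleyDickson r) - m t)) :
    φ.symm (image u f p ζ) =
      ∫ t, φ.symm (Real.exp (-(a * tailSum t 1)) • f t) * cis (m t) := by
  refine (φ.symm.toContinuousLinearEquiv.integral_comp_comm _).symm.trans
    (integral_congr_ae (Eventually.of_forall fun t => ?_))
  have h : φ.symm (-(u p t ζ)) = (-(a * tailSum t 1)) • (1 : CayleyDickson r) + m t := by
    rw [hu, ← map_neg, φ.symm_apply_apply]
    module
  simp only [LinearEquiv.coe_toContinuousLinearEquiv']
  rw [symm_mul φ hφ, map_exp φ.symm (symm_mul φ hφ), h, exp_eq_cis hr _ (hm t), map_smul,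
    CayleyDickson.smul_mul, CayleyDickson.mul_smul]

theorem frameCoord_map_ofCoord (φ : CayleyDickson r ≃ₗ[ℝ] CayleyDickson r) (c : ℕ → ℝ) (j : ℕ) :
    frameCoord φ (φ (ofCoord r c)) j = if j < 2 ^ r then c j else 0 := by
  rw [frameCoord, φ.symm_apply_apply, coord_ofCoord]

theorem isParameter_map_ofCoord (φ : CayleyDickson r ≃ₗ[ℝ] CayleyDickson r) {c : ℕ → ℝ}
    (hc : ∀ j, n < j → c j = 0) : IsParameter φ n (φ (ofCoord r c)) := fun j hj => by
  rw [frameCoord_map_ofCoord, hc j hj, ite_self]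

theorem re_ofCoord (c : ℕ → ℝ) : (ofCoord r c).re = c 0 := by
  simp [re, coord_ofCoord]

theorem coord_sum_smul_gen (a : ℕ → ℝ) (j : ℕ) :
    (∑ k ∈ Finset.Icc 1 (2 ^ r - 1), a k • gen r k).coord j =
      if j ∈ Finset.Icc 1 (2 ^ r - 1) then a j else 0 := by
  have h : ∀ k ∈ Finset.Icc 1 (2 ^ r - 1), (a k • gen r k).coord j = if j = k then a k else 0 := by
    intro k hk
    rw [Finset.mem_Icc] at hk
    rw [coord_smul, coord_gen]
    by_cases hjk : j = k
    · have : k < 2 ^ r := by omega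
      simp [hjk, this]
    · simp [hjk]
  rw [coord_sum, Finset.sum_congr rfl h, Finset.sum_ite_eq]

/-! ### The Cartesian phase: asymptotics in `ζ`. -/

section Cartesian

/-- The minus signs in the parameters compensate that of `e^{-u}`, so that `m` has coordinates `c_j
t_j + d_j`. -/
theorem cartesianPhase_eq (φ : CayleyDickson r ≃ₗ[ℝ] CayleyDickson r)
    (a : ℝ) (c d : ℕ → ℝ) (t : Fin n → ℝ) :
    cartesianPhase φ (φ (ofCoord r fun j => if j = 0 then a else -c j)) t
        (φ (ofCoord r fun j => if j = 0 then 0 else -d j)) =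
      φ ((a * tailSum t 1) • (1 : CayleyDickson r) -
        ofCoord r fun j => if j = 0 then 0 else c j * tCoord t j + d j) := by
  have h2 : 0 < 2 ^ r := by positivity
  simp only [cartesianPhase, ← map_smul, ← map_sum, ← map_add, frameCoord_map_ofCoord]
  congr 1
  refine ext_coord fun j hj => ?_
  simp only [coord_add, coord_sub, coord_smul, coord_sum_smul_gen, ← one_def, coord_one,
    coord_ofCoord, hj, h2, if_true, Finset.mem_Icc]
  rcases Nat.eq_zero_or_pos j with rfl | h
  · simp
  · have h3 : 1 ≤ j ∧ j ≤ 2 ^ r - 1 := by omega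
    rw [if_pos h3]
    simp [h.ne']
    ring

theorem continuous_ofCoord {X : Type*} [TopologicalSpace X] {c : X → ℕ → ℝ}
    (hc : ∀ j, Continuous fun x => c x j) : Continuous fun x => ofCoord r (c x) := by
  have h : ∀ x, ofCoord r (c x) = ∑ j ∈ Finset.range (2 ^ r), c x j • gen r j := by
    intro x
    refine ext_coord fun j hj => ?_
    simp only [coord_ofCoord, coord_sum, coord_smul, coord_gen, hj, if_true, and_true, mul_ite,
      mul_one, mul_zero, Finset.sum_ite_eq, Finset.mem_range]
  simp only [h]
  fun_prop

variable {E : Type*} [NormedAddCommGroup E] [InnerProductSpace ℝ E]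

theorem tendsto_unit_add_inv_smul (ω y : E) {R : ℕ → ℝ} (hR : Tendsto R atTop atTop) :
    Tendsto (fun k => ω + (R k)⁻¹ • y) atTop (𝓝 ω) := by
  simpa using tendsto_const_nhds.add
    ((tendsto_inv_atTop_zero.comp hR).smul (tendsto_const_nhds (x := y)))

theorem norm_smul_add_eq (ω y : E) {R : ℝ} (hR : 0 < R) :
    ‖R • ω + y‖ = R * ‖ω + R⁻¹ • y‖ := by
  have h : R • ω + y = R • (ω + R⁻¹ • y) := by
    rw [smul_add, smul_smul, mul_inv_cancel₀ hR.ne', one_smul]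
  rw [h, norm_smul, Real.norm_eq_abs, abs_of_pos hR]

/-- Asymptotically, the norm of `R ω + y` is `R + ⟪ω, y⟫`. -/
theorem tendsto_norm_smul_add_sub {ω : E} (hω : ‖ω‖ = 1) (y : E) {R : ℕ → ℝ}
    (hR : Tendsto R atTop atTop) :
    Tendsto (fun k => ‖R k • ω + y‖ - R k) atTop (𝓝 (inner ℝ ω y)) := by
  have h1 := (tendsto_unit_add_inv_smul ω y hR).norm
  rw [hω] at h1
  have h2 : Tendsto (fun k => (2 * inner ℝ ω y + (R k)⁻¹ * ‖y‖ ^ 2) / (‖ω + (R k)⁻¹ • y‖ + 1))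
      atTop (𝓝 ((2 * inner ℝ ω y + 0 * ‖y‖ ^ 2) / (1 + 1))) :=
    (tendsto_const_nhds.add ((tendsto_inv_atTop_zero.comp hR).mul_const _)).div
      (h1.add_const 1) (by norm_num)
  have h3 : (2 * inner ℝ ω y + 0 * ‖y‖ ^ 2) / (1 + 1) = inner ℝ ω y := by ring
  rw [h3] at h2
  -- Difference of squares: `N - R = (N² - R²) / (N + R)` with `N = ‖R ω + y‖`, numerator and
  -- denominator divided by `R`.
  refine h2.congr' ?_
  filter_upwards [hR.eventually_gt_atTop 0] with k hk
  have h4 : ‖R k • ω + y‖ ^ 2 = R k ^ 2 + 2 * R k * inner ℝ ω y + ‖y‖ ^ 2 := by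
    rw [norm_add_sq_real, norm_smul, hω, real_inner_smul_left, Real.norm_eq_abs, mul_one, sq_abs]
    ring
  have h5 := norm_smul_add_eq ω y hk
  rw [h5] at h4 ⊢
  have h6 : 0 < ‖ω + (R k)⁻¹ • y‖ + 1 := by positivity
  rw [div_eq_iff h6.ne']
  generalize ‖ω + (R k)⁻¹ • y‖ = N at h4
  linear_combination (-(R k)⁻¹) * h4 -
    (2 * inner ℝ ω y - R k * N ^ 2 + R k) * mul_inv_cancel₀ hk.ne'

/-- The norm is `R + ⟪ω, y⟫ + o(1)` and the direction tends to `ω`; since `R` is `x` modulo `2π`,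
the trigonometric factors converge although the norm does not. -/
theorem tendsto_cis {ω : CayleyDickson r} (hω : ‖ω‖ = 1) (y : CayleyDickson r) (x : ℝ) :
    Tendsto (fun k : ℕ => cis ((x + k * (2 * Real.pi)) • ω + y)) atTop
      (𝓝 (Real.cos (x + inner ℝ ω y) • (1 : CayleyDickson r) +
        Real.sin (x + inner ℝ ω y) • ω)) := by
  set R : ℕ → ℝ := fun k => x + k * (2 * Real.pi) with hRdef
  have hR : Tendsto R atTop atTop := tendsto_atTop_add_const_left _ _
    (tendsto_natCast_atTop_atTop.atTop_mul_const (by positivity))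
  have h1 : Tendsto (fun k => x + (‖R k • ω + y‖ - R k)) atTop (𝓝 (x + inner ℝ ω y)) :=
    (tendsto_norm_smul_add_sub hω y hR).const_add x
  have h0 := tendsto_unit_add_inv_smul ω y hR
  have h2 : Tendsto (fun k => ‖ω + (R k)⁻¹ • y‖⁻¹ • (ω + (R k)⁻¹ • y)) atTop (𝓝 ω) := by
    have h := (h0.norm.inv₀ (by rw [hω]; norm_num)).smul h0
    rwa [hω, inv_one, one_smul] at h
  have hper (k : ℕ) (y' : ℝ) : x + (y' - R k) = y' - k * (2 * Real.pi) := by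
    simp only [hRdef]
    ring
  have h3 := (((Real.continuous_cos.tendsto _).comp h1).smul
    (tendsto_const_nhds (x := (1 : CayleyDickson r)))).add
    (((Real.continuous_sin.tendsto _).comp h1).smul h2)
  have h4 : ∀ᶠ k in atTop, ‖ω + (R k)⁻¹ • y‖ ≠ 0 :=
    h0.norm.eventually_ne (by rw [hω]; exact one_ne_zero)
  refine h3.congr' ?_
  filter_upwards [hR.eventually_gt_atTop 0, h4] with k hk hne
  simp only [Function.comp_apply]
  rw [hper, Real.cos_sub_nat_mul_two_pi, Real.sin_sub_nat_mul_two_pi, cis]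
  have h5 := norm_smul_add_eq ω y hk
  have h6 : R k • ω + y = R k • (ω + (R k)⁻¹ • y) := by
    rw [smul_add, smul_smul, mul_inv_cancel₀ hk.ne', one_smul]
  have h7 : ‖R k • ω + y‖ ≠ 0 := by
    rw [h5]
    exact mul_ne_zero hk.ne' hne
  rw [Real.sinc_of_ne_zero h7]
  congr 1
  rw [h5, h6, smul_smul, smul_smul]
  congr 1
  field_simp

theorem ae_eq_zero_of_cartesian (hn : 1 ≤ n) (hn' : n ≤ 2 ^ r - 1)
    {H : (Fin n → ℝ) → CayleyDickson r} (hH : Integrable H)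
    (h : ∀ c d : ℕ → ℝ, (∀ j, n < j → c j = 0) → (∀ j, n < j → d j = 0) →
      ∫ t, H t * cis (ofCoord r fun j => if j = 0 then 0 else c j * tCoord t j + d j) = 0) :
    H =ᵐ[volume] 0 := by
  have hn0 : (0 : ℝ) < n := by exact_mod_cast hn
  have hs : 0 < Real.sqrt n := Real.sqrt_pos.2 hn0
  have hs2 : Real.sqrt n ^ 2 = n := Real.sq_sqrt hn0.le
  refine ae_eq_zero_of_integral_cos_eq_zero hH fun x ξ => ?_
  -- Any unit vector with nonzero entries exactly at `1, …, n` would do: the support keeps `ζ`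
  -- admissible, and nonzero entries let `⟪ω, y⟫` be any linear form in `t`.
  set w : ℕ → ℝ := fun j => if j ∈ Finset.Icc 1 n then (Real.sqrt n)⁻¹ else 0 with hw
  have hsub : Finset.Icc 1 n ⊆ Finset.range (2 ^ r) := by
    intro j hj
    rw [Finset.mem_Icc] at hj
    rw [Finset.mem_range]
    omega
  have hω : ‖ofCoord r w‖ = 1 := by
    have h1 : ‖ofCoord r w‖ ^ 2 = 1 := by
      rw [norm_sq_eq_sum, ← Finset.sum_subset hsub]
      · rw [Finset.sum_congr (g := fun _ => ((n : ℝ))⁻¹) rfl]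
        · simp [hn0.ne']
        · intro j hj
          simp only [coord_ofCoord, if_pos (Finset.mem_range.1 (hsub hj)), hw, if_pos hj, inv_pow,
            hs2]
      · intro j _ hj
        simp only [coord_ofCoord, hw, if_neg hj, ite_self, zero_pow two_ne_zero]
    nlinarith [norm_nonneg (ofCoord r w)]
  -- The sign `σ` enters both the direction and `y`, so the angle `ξ · t` is the same for `σ = 1`
  -- and `σ = -1` and only the sine term changes sign.
  have key (σ : ℝ) (hσ : σ * σ = 1) :
      (∫ t, Real.cos (x + ∑ j, ξ j * t j) • H t) +
        (∫ t, Real.sin (x + ∑ j, ξ j * t j) • H t) * (σ • ofCoord r w) = 0 := by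
    have hσω : ‖σ • ofCoord r w‖ = 1 := by
      rw [norm_smul, hω, mul_one, Real.norm_eq_abs, ← sq_eq_sq₀ (abs_nonneg _) zero_le_one, sq_abs,
        sq, hσ, one_pow]
    set y : (Fin n → ℝ) → CayleyDickson r := fun t =>
      ofCoord r fun j => if j = 0 then 0 else σ * Real.sqrt n * tCoord ξ j * tCoord t j with hy
    have hyc : Continuous y := by
      refine continuous_ofCoord fun j => ?_
      have := continuous_tCoord (n := n) j
      split_ifs <;> fun_prop
    have hinner (t : Fin n → ℝ) : inner ℝ (σ • ofCoord r w) (y t) = ∑ j, ξ j * t j := by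
      rw [← sum_Icc_tCoord_mul_tCoord, inner_eq_sum, ← Finset.sum_subset hsub]
      · refine Finset.sum_congr rfl fun j hj => ?_
        have hj0 : j ≠ 0 := by
          have := Finset.mem_Icc.1 hj
          omega
        simp only [hy, hw, coord_smul, coord_ofCoord, if_pos (Finset.mem_range.1 (hsub hj)),
          if_pos hj, if_neg hj0]
        field_simp
        linear_combination (tCoord ξ j * tCoord t j) * hσ
      · intro j _ hj
        simp only [coord_smul, coord_ofCoord, hw, if_neg hj, ite_self, mul_zero, zero_mul]
    have hm (k : ℕ) (t : Fin n → ℝ) : (x + k * (2 * Real.pi)) • (σ • ofCoord r w) + y t =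
        ofCoord r fun j => if j = 0 then 0 else (σ * Real.sqrt n * tCoord ξ j) * tCoord t j +
          (x + k * (2 * Real.pi)) * (σ * w j) := by
      refine ext_coord fun j hj => ?_
      simp only [hy, coord_add, coord_smul, coord_ofCoord, if_pos hj]
      by_cases hj0 : j = 0
      · simp [hj0, hw]
      · simp only [if_neg hj0]
        ring
    have hzero (k : ℕ) :
        ∫ t, H t * cis ((x + k * (2 * Real.pi)) • (σ • ofCoord r w) + y t) = 0 := by
      simp only [hm]
      refine h _ _ (fun j hj => ?_) fun j hj => ?_
      · rw [tCoord_of_notMem _ (by simp; omega), mul_zero]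
      · have : j ∉ Finset.Icc 1 n := by simp; omega
        simp only [hw, if_neg this, mul_zero]
    have hlim : Tendsto
        (fun k : ℕ => ∫ t, H t * cis ((x + k * (2 * Real.pi)) • (σ • ofCoord r w) + y t)) atTop
        (𝓝 (∫ t, H t * (Real.cos (x + ∑ j, ξ j * t j) • (1 : CayleyDickson r) +
          Real.sin (x + ∑ j, ξ j * t j) • (σ • ofCoord r w)))) := by
      refine tendsto_integral_of_dominated_convergence (fun t => ‖mulL r‖ * ‖H t‖ * 2)
        (fun k => ?_) ((hH.norm.const_mul _).mul_const _)
        (fun k => Eventually.of_forall fun t => ?_) (Eventually.of_forall fun t => ?_)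
      · exact (integrable_mul_of_bounded hH (continuous_cis.comp (by fun_prop))
          fun t => norm_cis_le _).aestronglyMeasurable
      · refine ((mulL r).le_opNorm₂ _ _).trans ?_
        gcongr
        exact norm_cis_le _
      · have h := tendsto_cis hσω (y t) x
        rw [hinner] at h
        exact ((mulL r (H t)).continuous.tendsto _).comp h
    simp only [hzero] at hlim
    have h0 := tendsto_nhds_unique hlim tendsto_const_nhds
    have hci : Integrable fun t => Real.cos (x + ∑ j, ξ j * t j) • H t :=
      integrable_smul_of_abs_le_one hH (by fun_prop) fun t => Real.abs_cos_le_one _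
    have hsi : Integrable fun t => Real.sin (x + ∑ j, ξ j * t j) • H t :=
      integrable_smul_of_abs_le_one hH (by fun_prop) fun t => Real.abs_sin_le_one _
    rw [← integral_mul_const hsi, ← integral_add hci]
    · rw [← h0]
      refine integral_congr_ae (Eventually.of_forall fun t => ?_)
      simp only [CayleyDickson.mul_add, CayleyDickson.mul_smul, CayleyDickson.smul_mul,
        CayleyDickson.mul_one, smul_comm σ]
    · exact integrable_mul_of_bounded hsi continuous_const fun _ => le_rfl
  have h1 := key 1 (by norm_num)
  have h2 := key (-1) (by norm_num)
  rw [one_smul] at h1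
  rw [neg_smul, one_smul, CayleyDickson.mul_neg] at h2
  have h3 := congrArg₂ (· + ·) h1 h2
  simp only [add_zero] at h3
  have h4 : (2 : ℝ) • (∫ t, Real.cos (x + ∑ j, ξ j * t j) • H t) = 0 := by
    rw [← h3]
    module
  exact (smul_eq_zero.1 h4).resolve_left (by norm_num)

end Cartesian

/-! ### The spherical phase: oddness in the last angle. -/

section Spherical

/-- The sum telescopes through `cos² = 1 - sin²`. The last component, `k = d`, has no cosine and
equals the square root of the remainder up to sign, whence `K < d`. -/
theorem sum_sphericalDir_sq (θ : ℕ → ℝ) {d K : ℕ} (hK : K < d) :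
    ∑ k ∈ Finset.Icc 1 K, sphericalDir θ d k ^ 2 =
      1 - ∏ l ∈ Finset.Icc 2 (K + 1), Real.sin (θ l) ^ 2 := by
  induction K with
  | zero => simp
  | succ K ih =>
    rw [Finset.sum_Icc_succ_top (by omega), ih (by omega),
      Finset.prod_Icc_succ_top (b := K + 1) (by omega), sphericalDir, if_pos hK, mul_pow,
      Finset.prod_pow, Real.cos_sq']
    ring

theorem norm_sum_sphericalDir (hr : 1 ≤ r) (θ : ℕ → ℝ) :
    ‖∑ k ∈ Finset.Icc 1 (2 ^ r - 1), sphericalDir θ (2 ^ r - 1) k • gen r k‖ = 1 := by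
  have h2 : 1 < 2 ^ r := Nat.one_lt_two_pow (by omega)
  obtain ⟨K, hK⟩ : ∃ K, 2 ^ r - 1 = K + 1 := ⟨2 ^ r - 2, by omega⟩
  have h : ‖∑ k ∈ Finset.Icc 1 (2 ^ r - 1), sphericalDir θ (2 ^ r - 1) k • gen r k‖ ^ 2 = 1 := by
    rw [norm_sq_eq_sum, ← Finset.sum_subset (s₁ := Finset.Icc 1 (2 ^ r - 1))]
    · rw [Finset.sum_congr (g := fun k => sphericalDir θ (2 ^ r - 1) k ^ 2) rfl
        fun j hj => by rw [coord_sum_smul_gen, if_pos hj], hK,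
        Finset.sum_Icc_succ_top (by omega), sum_sphericalDir_sq θ (Nat.lt_succ_self K),
        sphericalDir, if_neg (lt_irrefl _), mul_one, Finset.prod_pow]
      ring
    · intro j hj
      rw [Finset.mem_Icc] at hj
      rw [Finset.mem_range]
      omega
    · intro j _ hj
      rw [coord_sum_smul_gen, if_neg hj, zero_pow two_ne_zero]
  nlinarith [norm_nonneg (∑ k ∈ Finset.Icc 1 (2 ^ r - 1), sphericalDir θ (2 ^ r - 1) k • gen r k)]

/-- The vector with spherical coordinates `θ_1, …, θ_d`, where `d = 2 ^ r - 1`. -/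
noncomputable def sphericalVec (r : ℕ) (θ : ℕ → ℝ) : CayleyDickson r :=
  θ 1 • ∑ k ∈ Finset.Icc 1 (2 ^ r - 1), sphericalDir θ (2 ^ r - 1) k • gen r k

theorem re_sphericalVec (θ : ℕ → ℝ) : (sphericalVec r θ).re = 0 := by
  rw [sphericalVec, re, coord_smul, coord_sum_smul_gen]
  simp

theorem cis_neg_sphericalVec (hr : 1 ≤ r) (θ : ℕ → ℝ) :
    cis (-sphericalVec r θ) = Real.cos (θ 1) • (1 : CayleyDickson r) -
      Real.sin (θ 1) •
        ∑ k ∈ Finset.Icc 1 (2 ^ r - 1), sphericalDir θ (2 ^ r - 1) k • gen r k := by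
  rw [sphericalVec, ← neg_smul, cis_smul_of_norm_eq_one (norm_sum_sphericalDir hr θ), Real.cos_neg,
    Real.sin_neg, neg_smul, sub_eq_add_neg]

theorem sin_mul_sphericalDir (θ : ℕ → ℝ) (d : ℕ) {k : ℕ} (hk : 1 ≤ k) :
    Real.sin (θ 1) * sphericalDir θ d k =
      (∏ l ∈ Finset.Icc 1 k, Real.sin (θ l)) * if k < d then Real.cos (θ (k + 1)) else 1 := by
  rw [sphericalDir, ← mul_assoc]
  congr 1
  rw [← Finset.mul_prod_Ioc_eq_prod_Icc hk]
  rfl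

/-- The part of `exp (-M)` that is odd in the last angle `θ_n`. -/
theorem cis_neg_sphericalVec_sub (hr : 1 ≤ r) (hn : 1 ≤ n) (hn' : n ≤ 2 ^ r - 1) (θ : ℕ → ℝ)
    (hθ : ∀ j, n < j → θ j = 0) :
    cis (-sphericalVec r θ) - cis (-sphericalVec r (Function.update θ n (-θ n))) =
      (-2 * ∏ j ∈ Finset.Icc 1 n, Real.sin (θ j)) • gen r n := by
  set θ' := Function.update θ n (-θ n) with hθ'
  have hne {j : ℕ} (h : j ≠ n) : θ' j = θ j := Function.update_of_ne h _ _
  have heq : θ' n = -θ n := Function.update_self _ _ _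
  have hcos (j : ℕ) : Real.cos (θ' j) = Real.cos (θ j) := by
    by_cases h : j = n
    · rw [h, heq, Real.cos_neg]
    · rw [hne h]
  rw [cis_neg_sphericalVec hr, cis_neg_sphericalVec hr, hcos]
  refine ext_coord fun j hj => ?_
  simp only [coord_sub, coord_smul, coord_sum_smul_gen, coord_gen]
  by_cases hjm : j ∈ Finset.Icc 1 (2 ^ r - 1)
  · have hj1 : 1 ≤ j := (Finset.mem_Icc.1 hjm).1
    rw [if_pos hjm, if_pos hjm, sin_mul_sphericalDir _ _ hj1, sin_mul_sphericalDir _ _ hj1, hcos]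
    -- Below `n` the angle `θ_n` enters at most through a cosine; at `n` it enters through one sine,
    -- and the trailing factor is `1` as `θ_{n+1} = 0`; above `n` the factor `sin θ_{n+1} = 0`
    -- occurs.
    rcases lt_trichotomy j n with h | rfl | h
    · have hp : ∏ l ∈ Finset.Icc 1 j, Real.sin (θ' l) = ∏ l ∈ Finset.Icc 1 j, Real.sin (θ l) :=
        Finset.prod_congr rfl fun l hl => by
          rw [hne]
          have := Finset.mem_Icc.1 hl
          omega
      rw [hp, if_neg (by omega : ¬(j = n ∧ j < 2 ^ r))]
      ring
    · obtain ⟨i, rfl⟩ : ∃ i, j = i + 1 := ⟨j - 1, by omega⟩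
      have hp : ∏ l ∈ Finset.Icc 1 (i + 1), Real.sin (θ' l) =
          -∏ l ∈ Finset.Icc 1 (i + 1), Real.sin (θ l) := by
        rw [Finset.prod_Icc_succ_top (by omega), Finset.prod_Icc_succ_top (by omega), heq,
          Real.sin_neg, mul_neg]
        congr 2
        refine Finset.prod_congr rfl fun l hl => ?_
        rw [hne]
        have := Finset.mem_Icc.1 hl
        omega
      rw [hp, hθ (i + 1 + 1) (Nat.lt_succ_self _), Real.cos_zero, ite_self, if_pos ⟨rfl, hj⟩]
      ring
    · have hz {τ : ℕ → ℝ} (hτ : τ (n + 1) = 0) : ∏ l ∈ Finset.Icc 1 j, Real.sin (τ l) = 0 :=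
        Finset.prod_eq_zero (i := n + 1) (by rw [Finset.mem_Icc]; omega) (by rw [hτ, Real.sin_zero])
      rw [hz (hθ _ (Nat.lt_succ_self n)), hz ((hne (by omega)).trans (hθ _ (Nat.lt_succ_self n))),
        if_neg (by omega : ¬(j = n ∧ j < 2 ^ r))]
      ring
  · have : j ≠ n := by
      rw [Finset.mem_Icc] at hjm
      omega
    simp [hjm, this]

theorem continuous_sphericalVec {X : Type*} [TopologicalSpace X] {θ : X → ℕ → ℝ}
    (hθ : ∀ j, Continuous fun x => θ x j) : Continuous fun x => sphericalVec r (θ x) := by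
  unfold sphericalVec
  have h (d k : ℕ) : Continuous fun x => sphericalDir (θ x) d k := by
    unfold sphericalDir
    split_ifs <;> fun_prop
  fun_prop

theorem sphericalDir_congr {θ θ' : ℕ → ℝ} (h : ∀ j, 1 ≤ j → θ j = θ' j) (d k : ℕ) :
    sphericalDir θ d k = sphericalDir θ' d k := by
  rw [sphericalDir, sphericalDir, h (k + 1) (by omega)]
  congr 1
  refine Finset.prod_congr rfl fun l hl => ?_
  rw [h l]
  have := Finset.mem_Icc.1 hl
  omega

theorem sphericalPhase_eq (hn' : n ≤ 2 ^ r - 1) (φ : CayleyDickson r ≃ₗ[ℝ] CayleyDickson r)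
    (a : ℝ) {c d : ℕ → ℝ} (hc : ∀ j, n < j → c j = 0) (hd : ∀ j, n < j → d j = 0)
    (t : Fin n → ℝ) :
    sphericalPhase φ (φ (ofCoord r fun j => if j = 0 then a else c j)) t
        (φ (ofCoord r fun j => if j = 0 then 0 else d j)) =
      φ ((a * tailSum t 1) • (1 : CayleyDickson r) -
        -sphericalVec r fun j => c j * tailSum t j + d j) := by
  have hangle : ∀ j, 1 ≤ j → angle φ (φ (ofCoord r fun j => if j = 0 then a else c j)) t
      (φ (ofCoord r fun j => if j = 0 then 0 else d j)) j = c j * tailSum t j + d j := by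
    intro j hj
    have hj0 : j ≠ 0 := by omega
    simp only [angle, frameCoord_map_ofCoord, if_neg hj0]
    by_cases h : j < 2 ^ r
    · simp only [if_pos h]
    · have : n < j := by
        have : 0 < 2 ^ r := by positivity
        omega
      simp only [if_neg h, hc j this, hd j this]
  have h2 : 0 < 2 ^ r := by positivity
  rw [sphericalPhase, hangle 1 le_rfl, sphericalVec]
  simp only [frameCoord_map_ofCoord, if_pos h2, if_true, sphericalDir_congr hangle, ← map_smul,
    ← map_sum, ← map_add, ← one_def]
  congr 1
  module

theorem ae_eq_zero_of_spherical (hr : 1 ≤ r) (hn : 1 ≤ n) (hn' : n ≤ 2 ^ r - 1)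
    {H : (Fin n → ℝ) → CayleyDickson r} (hH : Integrable H)
    (h : ∀ c d : ℕ → ℝ, (∀ j, n < j → c j = 0) → (∀ j, n < j → d j = 0) →
      ∫ t, H t * cis (-sphericalVec r fun j => c j * tailSum t j + d j) = 0) :
    H =ᵐ[volume] 0 := by
  refine ae_eq_zero_of_integral_prod_sin_eq_zero hH fun c₀ d₀ => ?_
  -- Admissible parameters vanish beyond `n`; truncation does not affect a product over `1, …, n`.
  set c : ℕ → ℝ := fun j => if n < j then 0 else c₀ j with hcdef
  set d : ℕ → ℝ := fun j => if n < j then 0 else d₀ j with hddef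
  have hc : ∀ j, n < j → c j = 0 := fun j hj => if_pos hj
  have hd : ∀ j, n < j → d j = 0 := fun j hj => if_pos hj
  have hprod (t : Fin n → ℝ) : ∏ j ∈ Finset.Icc 1 n, Real.sin (c₀ j * tailSum t j + d₀ j) =
      ∏ j ∈ Finset.Icc 1 n, Real.sin (c j * tailSum t j + d j) :=
    Finset.prod_congr rfl fun j hj => by
      have : ¬n < j := not_lt.2 (Finset.mem_Icc.1 hj).2
      simp only [hcdef, hddef, if_neg this]
  simp only [hprod]
  -- Negating the `n`-th coordinates of both `p` and `ζ` negates `θ_n` for all `t` at once, and is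
  -- again an admissible choice.
  have hflip (t : Fin n → ℝ) : (fun j => Function.update c n (-c n) j * tailSum t j +
      Function.update d n (-d n) j) =
      Function.update (fun j => c j * tailSum t j + d j) n (-(c n * tailSum t n + d n)) := by
    funext j
    by_cases hj : j = n
    · subst hj
      simp
      ring
    · simp [hj]
  have h1 := h c d hc hd
  have h2 := h (Function.update c n (-c n)) (Function.update d n (-d n))
    (fun j hj => by rw [Function.update_of_ne hj.ne', hc j hj])
    (fun j hj => by rw [Function.update_of_ne hj.ne', hd j hj])
  have hi (c d : ℕ → ℝ) :
      Integrable fun t => H t * cis (-sphericalVec r fun j => c j * tailSum t j + d j) := by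
    refine integrable_mul_of_bounded hH (continuous_cis.comp (continuous_sphericalVec
      fun j => ?_).neg) fun t => norm_cis_le _
    have := continuous_tailSum (n := n) j
    fun_prop
  have h3 := integral_sub (hi c d) (hi (Function.update c n (-c n)) (Function.update d n (-d n)))
  rw [h1, h2, sub_zero] at h3
  have h4 (t : Fin n → ℝ) :
      H t * cis (-sphericalVec r fun j => c j * tailSum t j + d j) -
        H t * cis (-sphericalVec r fun j => Function.update c n (-c n) j * tailSum t j +
          Function.update d n (-d n) j) =
      (-2 : ℝ) •
        (((∏ j ∈ Finset.Icc 1 n, Real.sin (c j * tailSum t j + d j)) • H t) * gen r n) := by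
    rw [← CayleyDickson.mul_sub, hflip, cis_neg_sphericalVec_sub hr hn hn' _ fun j hj => by
      simp [hc j hj, hd j hj], CayleyDickson.mul_smul, CayleyDickson.smul_mul, smul_smul]
  simp only [h4] at h3
  rw [integral_smul, integral_mul_const] at h3
  · refine (mul_gen_eq_zero (by omega)).1 _ ((smul_eq_zero.1 h3).resolve_left (by norm_num))
  · refine integrable_smul_of_abs_le_one hH ?_ fun t => ?_
    · have := continuous_tailSum (n := n)
      fun_prop
    · rw [Finset.abs_prod]
      exact Finset.prod_le_one (fun _ _ => abs_nonneg _) fun _ _ => Real.abs_sin_le_one _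

end Spherical

end NoncommLaplace

/-! ### Assembly. -/

open CayleyDickson NoncommLaplace in
theorem theorem7 (r n : ℕ) (hr : 1 ≤ r) (hn : 2 ^ (r - 1) ≤ n) (hn' : n ≤ 2 ^ r - 1)
    (φ : CayleyDickson r ≃ₗ[ℝ] CayleyDickson r) (hφ : ∀ x y, φ (x * y) = φ x * φ y)
    (u : CayleyDickson r → (Fin n → ℝ) → CayleyDickson r → CayleyDickson r)
    (hu : u = cartesianPhase φ ∨ u = sphericalPhase φ)
    (f g : (Fin n → ℝ) → CayleyDickson r) (af bf ag bg : ℝ)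
    (hf : IsOriginal af bf f) (hg : IsOriginal ag bg g) (hstrip : max af ag < min bf bg)
    (himage : ∀ p ζ : CayleyDickson r, IsParameter φ n p → IsParameter φ n ζ →
      max af ag < p.re → p.re < min bf bg → image u f p ζ = image u g p ζ)
    (t : Fin n → ℝ) (hft : ContinuousAt f t) (hgt : ContinuousAt g t) :
    f t = g t := by
  have hn1 : 1 ≤ n := Nat.one_le_two_pow.trans hn
  -- A single real part suffices: only the imaginary coordinates of `p` and `ζ` vary below.
  obtain ⟨a, ha1, ha2⟩ := exists_between hstrip
  have hfi := hf.integrable_exp_smul ((le_max_left _ _).trans_lt ha1)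
    (ha2.trans_le (min_le_left _ _))
  have hgi := hg.integrable_exp_smul ((le_max_right _ _).trans_lt ha1)
    (ha2.trans_le (min_le_right _ _))
  have hfi' := φ.symm.toContinuousLinearEquiv.toContinuousLinearMap.integrable_comp hfi
  have hgi' := φ.symm.toContinuousLinearEquiv.toContinuousLinearMap.integrable_comp hgi
  set F : (Fin n → ℝ) → CayleyDickson r := fun t =>
    φ.symm (Real.exp (-(a * tailSum t 1)) • f t)
  set G : (Fin n → ℝ) → CayleyDickson r := fun t =>
    φ.symm (Real.exp (-(a * tailSum t 1)) • g t)
  replace hfi' : Integrable F := hfi'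
  replace hgi' : Integrable G := hgi'
  have hzero : ∀ (p ζ : CayleyDickson r) (m : (Fin n → ℝ) → CayleyDickson r),
      IsParameter φ n p → IsParameter φ n ζ → p.re = a → (∀ t, (m t).re = 0) → Continuous m →
      (∀ t, u p t ζ = φ ((a * tailSum t 1) • (1 : CayleyDickson r) - m t)) →
      ∫ t, (F t - G t) * cis (m t) = 0 := by
    intro p ζ m hp hζ hpa hm hmc hum
    have h := congrArg φ.symm
      (himage p ζ hp hζ (by rw [hpa]; exact ha1) (by rw [hpa]; exact ha2))
    rw [symm_image_eq hr φ hφ u f p ζ a m hm hum, symm_image_eq hr φ hφ u g p ζ a m hm hum] at h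
    simp only [CayleyDickson.sub_mul]
    have hi {F : (Fin n → ℝ) → CayleyDickson r} (hF : Integrable F) :
        Integrable fun t => F t * cis (m t) :=
      integrable_mul_of_bounded hF (continuous_cis.comp hmc) fun t => norm_cis_le _
    rw [integral_sub (hi hfi') (hi hgi'), sub_eq_zero]
    exact h
  have hpar {a : ℝ} {c : ℕ → ℝ} (hc : ∀ j, n < j → c j = 0) :
      IsParameter φ n (φ (ofCoord r fun j => if j = 0 then a else c j)) :=
    isParameter_map_ofCoord φ fun j hj => by rw [if_neg (by omega), hc j hj]
  have hre (c : ℕ → ℝ) : (φ (ofCoord r fun j => if j = 0 then a else c j)).re = a := by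
    rw [re_map φ hφ, re_ofCoord, if_pos rfl]
  have hae : (fun t => F t - G t) =ᵐ[volume] 0 := by
    rcases hu with rfl | rfl
    · refine ae_eq_zero_of_cartesian hn1 hn' (hfi'.sub hgi') fun c d hc hd => ?_
      refine hzero (φ (ofCoord r fun j => if j = 0 then a else -c j))
        (φ (ofCoord r fun j => if j = 0 then 0 else -d j)) _
        (hpar fun j hj => by rw [hc j hj, neg_zero]) (hpar fun j hj => by rw [hd j hj, neg_zero])
        (hre _) (fun t => re_ofCoord _) (continuous_ofCoord fun j => ?_)
        (cartesianPhase_eq φ a c d)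
      have := continuous_tCoord (n := n) j
      split_ifs <;> fun_prop
    · refine ae_eq_zero_of_spherical hr hn1 hn' (hfi'.sub hgi') fun c d hc hd => ?_
      refine hzero _ _ _ (hpar hc) (hpar hd) (hre _) (fun t => ?_)
        (continuous_sphericalVec fun j => ?_).neg (sphericalPhase_eq hn' φ a hc hd)
      · rw [re, coord_neg, neg_eq_zero]
        exact re_sphericalVec _
      · have := continuous_tailSum (n := n) j
        fun_prop
  have hexp : Continuous fun t : Fin n → ℝ => Real.exp (-(a * tailSum t 1)) := by
    have := continuous_tailSum (n := n) 1
    fun_prop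
  have hφc : Continuous φ.symm := φ.symm.toContinuousLinearEquiv.continuous
  have h0 := eq_zero_of_ae_eq_zero_of_continuousAt hae (t := t)
    ((hφc.continuousAt.comp (hexp.continuousAt.smul hft)).sub
      (hφc.continuousAt.comp (hexp.continuousAt.smul hgt)))
  exact smul_right_injective _ (Real.exp_pos _).ne' (φ.symm.injective (sub_eq_zero.1 h0))
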